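/- Let $n\ge 1$, $\varepsilon\in(0,1]$, $\delta>0$, and let $\Omega\subset\mathbb R^n$ be an $(\varepsilon,\delta)$-domain: $\Omega$ is open and connected (and non-empty), and any two points $x\ne y$ of $\Omega$ with $|x-y|<\delta$ can be joined by a rectifiable curve $\gamma\subset\Omega$ of length at most $\varepsilon^{-1}|x-y|$ such that $\operatorname{dist}(z,\partial\Omega)\ge \varepsilon\,\frac{|z-x||z-y|}{|x-y|}$ for every $z$ on $\gamma$. Distances to or from the empty set are $\infty$. Put $\lambda=\frac{\varepsilon^2\delta}{320\,n\,(1+\sqrt n\,\varepsilon)}$. Cubes are closed with sides parallel to the axes; $\ell(Q)>0$ is the sidelength of $Q$ and $f_Q$ is the average of $f$ over $Q$. For an open set $U\subset\mathbb R^n$ put $$\|f\|_{\mathrm{bmo}(U)}:=\sup_{Q\subset U,\ \ell(Q)<\lambda}\frac1{|Q|}\int_Q|f-f_Q|\,dx+\sup_{Q\subset U,\ \ell(Q)\ge\lambda}\frac1{|Q|}\int_Q|f|\,dx,$$ a supremum over no cubes being $0$. Let $\mathrm{bmo}(\Omega)$ be the set of real functions $f$ on $\Omega$ that are integrable on every cube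 $Q\subset\Omega$ and satisfy $\|f\|_{\mathrm{bmo}(\Omega)}<\infty$, and let $\mathrm{bmo}_c(\Omega)$ be the set of those $f\in \mathrm{bmo}(\Omega)$ whose support is a compact subset of $\Omega$. Here $\operatorname{supp}(f)$ is the complement in $\mathbb R^n$ of the largest open set $V$ such that $f=0$ almost everywhere on $V\cap\Omega$. Say that $f\in \mathrm{bmo}(\Omega)$ vanishes at the boundary if $\lim_{t\to0^+}\|f\|_{\mathrm{bmo}(\{x\in\Omega:\ \operatorname{dist}(x,\partial\Omega)<t\})}=0$, and that it vanishes at infinity if $\lim_{R\to\infty}\|f\|_{\mathrm{bmo}(\Omega\setminus\overline{B(0,R)})}=0$. Let $f\in\mathrm{bmo}(\Omega)$. Then the following are equivalent: (i) there is a sequence $(f_j)$ in $\mathrm{bmo}(\Omega)$ with $\operatorname{dist}(\operatorname{supp}(f_j),\partial\Omega)>0$ for each $j$ and $\|f_j-f\|_{\mathrm{bmo}(\Omega)}\to0$; (ii) $f$ vanishes at the boundary. Moreover, the following are equivalent: (a) $f$ is in the closure of $\mathrm{bmo}_c(\Omega)$ in $\mathrm{bmo}(\Omega)$, that is, for every $\eta>0$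 there is $g\in\mathrm{bmo}_c(\Omega)$ with $\|f-g\|_{\mathrm{bmo}(\Omega)}<\eta$; (b) $f$ vanishes at the boundary and vanishes at infinity. -/

import Mathlib

open MeasureTheory Set Filter Topology
open scoped ENNReal

/-- The closed cube in `ℝⁿ` with sides parallel to the axes, lower corner `a` and sidelength `l`. -/
def cube {n : ℕ} (a : EuclideanSpace ℝ (Fin n)) (l : ℝ) : Set (EuclideanSpace ℝ (Fin n)) :=
  {x | ∀ i, x i ∈ Icc (a i) (a i + l)}

/-- The modulus of mean oscillation `ω_Ω(f, t)`: the supremum of the mean oscillations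
`⨍_Q |f - f_Q|` over all cubes `Q ⊆ Ω` of sidelength less than `t`. -/
noncomputable def meanOscModulus {n : ℕ} (Ω : Set (EuclideanSpace ℝ (Fin n)))
    (f : EuclideanSpace ℝ (Fin n) → ℝ) (t : ℝ) : ℝ≥0∞ :=
  ⨆ (a : EuclideanSpace ℝ (Fin n)) (l : ℝ) (_ : 0 < l) (_ : l < t) (_ : cube a l ⊆ Ω),
    ⨍⁻ x in cube a l, ‖f x - ⨍ y in cube a l, f y‖ₑ ∂volume

/-- The supremum of the averages `|f|_Q` over all cubes `Q ⊆ Ω` of sidelength at least `lam`. -/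
noncomputable def largeCubeAverage {n : ℕ} (Ω : Set (EuclideanSpace ℝ (Fin n)))
    (f : EuclideanSpace ℝ (Fin n) → ℝ) (lam : ℝ) : ℝ≥0∞ :=
  ⨆ (a : EuclideanSpace ℝ (Fin n)) (l : ℝ) (_ : 0 < l) (_ : lam ≤ l) (_ : cube a l ⊆ Ω),
    ⨍⁻ x in cube a l, ‖f x‖ₑ ∂volume

/-- The (extended) norm of `bmo_lam(Ω)`. Only the values of `f` on `Ω` matter. -/
noncomputable def bmoNorm {n : ℕ} (lam : ℝ) (Ω : Set (EuclideanSpace ℝ (Fin n)))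
    (f : EuclideanSpace ℝ (Fin n) → ℝ) : ℝ≥0∞ :=
  meanOscModulus Ω f lam + largeCubeAverage Ω f lam

/-- `f ∈ bmo_lam(Ω)`: `f` is integrable on every cube contained in `Ω`, and its norm is finite. -/
def MemBmo {n : ℕ} (lam : ℝ) (Ω : Set (EuclideanSpace ℝ (Fin n)))
    (f : EuclideanSpace ℝ (Fin n) → ℝ) : Prop :=
  (∀ (a : EuclideanSpace ℝ (Fin n)) (l : ℝ), 0 < l → cube a l ⊆ Ω →
    IntegrableOn f (cube a l)) ∧ bmoNorm lam Ω f < ∞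

/-- The (essential) support in `ℝⁿ` of a function on `Ω` that is determined almost everywhere: the
complement of the largest open set `U` such that `f = 0` almost everywhere on `U ∩ Ω`. -/
def suppIn {n : ℕ} (Ω : Set (EuclideanSpace ℝ (Fin n)))
    (f : EuclideanSpace ℝ (Fin n) → ℝ) : Set (EuclideanSpace ℝ (Fin n)) :=
  {x | ∀ U ∈ 𝓝 x, 0 < volume (U ∩ (Ω ∩ Function.support f))}

/-- The distance between two sets, with value `∞` if one of them is empty. -/
noncomputable def setDist {n : ℕ} (A B : Set (EuclideanSpace ℝ (Fin n))) : ℝ≥0∞ :=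
  ⨅ x ∈ A, Metric.infEDist x B

/-- `f ∈ bmo_{lam,c}(Ω)`: the functions in `bmo_lam(Ω)` with compact support in `Ω`. -/
def MemBmoC {n : ℕ} (lam : ℝ) (Ω : Set (EuclideanSpace ℝ (Fin n)))
    (f : EuclideanSpace ℝ (Fin n) → ℝ) : Prop :=
  MemBmo lam Ω f ∧ IsCompact (suppIn Ω f) ∧ suppIn Ω f ⊆ Ω

/-- The points of `Ω` at distance at least `t` from the boundary of `Ω` (all of them, if the
boundary is empty). -/
def innerSet {n : ℕ} (Ω : Set (EuclideanSpace ℝ (Fin n))) (t : ℝ) :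
    Set (EuclideanSpace ℝ (Fin n)) :=
  {x | x ∈ Ω ∧ ENNReal.ofReal t ≤ Metric.infEDist x (frontier Ω)}

/-- `f` vanishes at infinity, in the sense of `bmo_lam(Ω)`. -/
def VanishesAtInfinity {n : ℕ} (lam : ℝ) (Ω : Set (EuclideanSpace ℝ (Fin n)))
    (f : EuclideanSpace ℝ (Fin n) → ℝ) : Prop :=
  Tendsto (fun R : ℝ => bmoNorm lam (Ω \ Metric.closedBall 0 R) f) atTop (𝓝 0)

/-- `f` vanishes at the boundary, in the sense of `bmo_lam(Ω)`. -/
def VanishesAtBoundary {n : ℕ} (lam : ℝ) (Ω : Set (EuclideanSpace ℝ (Fin n)))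
    (f : EuclideanSpace ℝ (Fin n) → ℝ) : Prop :=
  Tendsto (fun t : ℝ => bmoNorm lam (Ω \ innerSet Ω t) f) (𝓝[>] 0) (𝓝 0)

/-- `f` is in the closure, in the norm of `bmo_lam(Ω)`, of a set `S` of functions. -/
def InBmoClosure {n : ℕ} (lam : ℝ) (Ω : Set (EuclideanSpace ℝ (Fin n)))
    (S : Set (EuclideanSpace ℝ (Fin n) → ℝ)) (f : EuclideanSpace ℝ (Fin n) → ℝ) : Prop :=
  ∀ η : ℝ≥0∞, 0 < η → ∃ g ∈ S, bmoNorm lam Ω (f - g) < η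

/-- `(ε, δ)`-domains: domains `Ω` such that any two distinct points `x, y ∈ Ω` with `|x - y| < δ`
are joined by a curve in `Ω` of length at most `|x - y| / ε`, every point `z` of which is at distance
at least `ε |z - x| |z - y| / |x - y|` from the boundary of `Ω`. -/
structure IsEpsDeltaDomain {n : ℕ} (ε δ : ℝ) (Ω : Set (EuclideanSpace ℝ (Fin n))) : Prop where
  eps_pos : 0 < ε
  eps_le_one : ε ≤ 1
  delta_pos : 0 < δ
  isOpen : IsOpen Ω
  isConnected : IsConnected Ω
  exists_curve : ∀ x ∈ Ω, ∀ y ∈ Ω, x ≠ y → dist x y < δ →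
    ∃ γ : Path x y, (∀ s, γ s ∈ Ω) ∧
      eVariationOn γ univ ≤ ENNReal.ofReal (ε⁻¹ * dist x y) ∧
      ∀ s, ENNReal.ofReal (ε * (dist (γ s) x * dist (γ s) y / dist x y)) ≤
        Metric.infEDist (γ s) (frontier Ω)

/-- The scale `ε² δ / (320 n (1 + √n ε))` at which `bmo(Ω)` is defined for an `(ε, δ)`-domain `Ω`
in `ℝⁿ`. -/
noncomputable def naturalScale (n : ℕ) (ε δ : ℝ) : ℝ :=
  ε ^ 2 * δ / (320 * n * (1 + √n * ε))

/-!
In both equivalences, vanishing is inherited from an approximating function, because the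
restriction of such a function to a layer at the boundary, or to the exterior of a large ball, is
zero almost everywhere. For the converse, the approximating function is `f - φ f`, where `φ` is a
cutoff function equal to `1` near the boundary, or near infinity, such that `φ f` has small norm.

Multiplication by a cutoff function is harmless for mean oscillation only up to a term
`|f_Q| ⨍_Q |φ - φ(x₀)|` (`meanOsc_mul_le`), so two facts are needed.

* The averages `f_Q` grow at most like `log (1 / l(Q))`
  (`IsEpsDeltaDomain.exists_hasLogGrowth`). This is where the geometry of the domain is used: from
  a point whose distance to the boundary is at least `r`, a curve of the `(ε, δ)`-condition leads
  to a point at distance at least `2 r` from the boundary, and a bounded number of overlapping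
  cubes of size comparable to `r` connects the two, so that `f_Q` changes by a bounded amount.
  After about `log (1 / r)` such steps a cube of sidelength `naturalScale n ε δ` is reached, where
  the norm controls the average, unless the domain is so small that a fixed cube is reached first.
* At the boundary, `φ` is a truncation of `s log (log (T / d))`, with `d` the distance to the
  boundary, whose oscillation on a Whitney cube is of order `s / log (1 / l(Q))`. On a cube that
  touches the boundary, `d` is compared with its value at the centre through the integrability of
  `log (1 / d)` (`one_add_posLog_mul_setLAverage_log_infDist_le`). At infinity, a cutoff function
  with a small Lipschitz constant is enough.

The cubes that reach from the support of `φ` far into the interior have sidelength bounded below.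
The support meets them in a thin layer at their faces, which a subdivision into small cubes and
the logarithmic growth show to contribute little (`exists_forall_average_mul_le`).
-/

/-! ### Averages -/

section Averages

variable {α : Type*} [MeasurableSpace α] {μ : Measure α} {s t : Set α}

theorem enorm_setAverage_sub_le {f : α → ℝ} (h0 : μ s ≠ 0) (hs : μ s ≠ ∞)
    (hf : IntegrableOn f s μ) (c : ℝ) :
    ‖(⨍ x in s, f x ∂μ) - c‖ₑ ≤ ⨍⁻ x in s, ‖f x - c‖ₑ ∂μ := by
  have : IsFiniteMeasure (μ.restrict s) := ⟨by simpa using hs.lt_top⟩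
  have : NeZero (μ.restrict s) := ⟨by simpa using h0⟩
  have hc : (⨍ x in s, f x ∂μ) - c = ⨍ x in s, (f x - c) ∂μ := by
    have h1 : ⨍ _x in s, c ∂μ = c := setAverage_const h0 hs c
    conv_lhs => rw [← h1]
    rw [average_eq', average_eq', average_eq', integral_sub]
    · exact Integrable.to_average hf
    · exact integrable_const _
  rw [hc, average_eq', laverage_eq']
  exact enorm_integral_le_lintegral_enorm _

theorem setLAverage_add_const {g : α → ℝ≥0∞} (h0 : μ s ≠ 0) (hs : μ s ≠ ∞) (c : ℝ≥0∞) :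
    ⨍⁻ x in s, (g x + c) ∂μ = (⨍⁻ x in s, g x ∂μ) + c := by
  have h1 : ⨍⁻ _x in s, c ∂μ = c := setLAverage_const h0 hs c
  conv_rhs => rw [← h1]
  rw [laverage_eq', laverage_eq', laverage_eq', lintegral_add_right _ measurable_const]

theorem meanOsc_le_two_mul {f : α → ℝ} (h0 : μ s ≠ 0) (hs : μ s ≠ ∞)
    (hf : IntegrableOn f s μ) (c : ℝ) :
    ⨍⁻ x in s, ‖f x - ⨍ y in s, f y ∂μ‖ₑ ∂μ ≤ 2 * ⨍⁻ x in s, ‖f x - c‖ₑ ∂μ := by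
  calc ⨍⁻ x in s, ‖f x - ⨍ y in s, f y ∂μ‖ₑ ∂μ
      ≤ ⨍⁻ x in s, (‖f x - c‖ₑ + ‖(⨍ y in s, f y ∂μ) - c‖ₑ) ∂μ := by
        apply laverage_mono_ae
        refine Eventually.of_forall fun x => ?_
        have : f x - ⨍ y in s, f y ∂μ = (f x - c) - ((⨍ y in s, f y ∂μ) - c) := by ring
        simp only [this]
        exact enorm_sub_le
    _ = (⨍⁻ x in s, ‖f x - c‖ₑ ∂μ) + ‖(⨍ y in s, f y ∂μ) - c‖ₑ :=
        setLAverage_add_const h0 hs _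
    _ ≤ _ := by
        rw [two_mul]
        gcongr
        exact enorm_setAverage_sub_le h0 hs hf c

theorem setLAverage_le_of_subset (h0 : μ t ≠ 0) (ht : μ t ≠ ∞) (hst : s ⊆ t)
    (g : α → ℝ≥0∞) : ⨍⁻ x in s, g x ∂μ ≤ μ t / μ s * ⨍⁻ x in t, g x ∂μ := by
  rw [setLAverage_eq, setLAverage_eq]
  calc (∫⁻ x in s, g x ∂μ) / μ s ≤ (∫⁻ x in t, g x ∂μ) / μ s := by
        gcongr
    _ = _ := by
        rw [ENNReal.div_eq_inv_mul, ENNReal.div_eq_inv_mul, ENNReal.div_eq_inv_mul,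
          mul_assoc, ← mul_assoc (μ t), ENNReal.mul_inv_cancel h0 ht, one_mul]

theorem setLAverage_le_of_forall_le (hm : MeasurableSet s)
    {g : α → ℝ≥0∞} {c : ℝ≥0∞} (h : ∀ x ∈ s, g x ≤ c) : ⨍⁻ x in s, g x ∂μ ≤ c := by
  rw [setLAverage_eq]
  refine ENNReal.div_le_of_le_mul ?_
  calc ∫⁻ x in s, g x ∂μ ≤ ∫⁻ _x in s, c ∂μ := setLIntegral_mono' hm h
    _ = c * μ s := by simp

theorem setLAverage_mono_on (hm : MeasurableSet s) {g h : α → ℝ≥0∞}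
    (hgh : ∀ x ∈ s, g x ≤ h x) : ⨍⁻ x in s, g x ∂μ ≤ ⨍⁻ x in s, h x ∂μ := by
  rw [setLAverage_eq, setLAverage_eq]
  gcongr ?_ / _
  exact setLIntegral_mono' hm hgh

end Averages

/-! ### Cubes -/

section Cubes

variable {n : ℕ}

theorem mem_cube {a x : EuclideanSpace ℝ (Fin n)} {l : ℝ} :
    x ∈ cube a l ↔ ∀ i, a i ≤ x i ∧ x i ≤ a i + l := Iff.rfl

theorem cube_eq_preimage (a : EuclideanSpace ℝ (Fin n)) (l : ℝ) :
    cube a l = (WithLp.ofLp : EuclideanSpace ℝ (Fin n) → (Fin n → ℝ)) ⁻¹'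
      Icc (WithLp.ofLp a) (fun i => a i + l) := by
  ext x
  simp only [mem_cube, mem_preimage, mem_Icc, Pi.le_def]
  exact forall_and

theorem isClosed_cube (a : EuclideanSpace ℝ (Fin n)) (l : ℝ) : IsClosed (cube a l) := by
  rw [cube_eq_preimage]
  exact isClosed_Icc.preimage (by fun_prop)

theorem measurableSet_cube (a : EuclideanSpace ℝ (Fin n)) (l : ℝ) : MeasurableSet (cube a l) :=
  (isClosed_cube a l).measurableSet

theorem volume_cube (a : EuclideanSpace ℝ (Fin n)) (l : ℝ) :
    volume (cube a l) = ENNReal.ofReal l ^ n := by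
  rw [cube_eq_preimage, (PiLp.volume_preserving_ofLp (Fin n)).measure_preimage
    measurableSet_Icc.nullMeasurableSet, Real.volume_Icc_pi]
  simp

theorem volume_cube_ne_zero (a : EuclideanSpace ℝ (Fin n)) {l : ℝ} (hl : 0 < l) :
    volume (cube a l) ≠ 0 := by
  rw [volume_cube]
  exact pow_ne_zero _ (by simpa using hl)

theorem volume_cube_ne_top (a : EuclideanSpace ℝ (Fin n)) (l : ℝ) :
    volume (cube a l) ≠ ∞ := by
  rw [volume_cube]
  exact ENNReal.pow_ne_top ENNReal.ofReal_ne_top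

theorem volume_cube_div (a b : EuclideanSpace ℝ (Fin n)) {l k : ℝ} (hl : 0 ≤ l) (hk : 0 < k) :
    volume (cube a l) / volume (cube b k) = ENNReal.ofReal ((l / k) ^ n) := by
  rw [volume_cube, volume_cube, ← ENNReal.ofReal_pow hl, ← ENNReal.ofReal_pow hk.le,
    ← ENNReal.ofReal_div_of_pos (by positivity), div_pow]

theorem dist_le_of_coord_le {x y : EuclideanSpace ℝ (Fin n)} {h : ℝ} (hh : 0 ≤ h)
    (H : ∀ i, |x i - y i| ≤ h) : dist x y ≤ √n * h := by
  rw [EuclideanSpace.dist_eq]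
  calc √(∑ i, dist (x i) (y i) ^ 2) ≤ √(∑ _i : Fin n, h ^ 2) := by
        gcongr with i
        exact H i
    _ = √n * h := by
        rw [Finset.sum_const, Finset.card_univ, Fintype.card_fin, nsmul_eq_mul,
          Real.sqrt_mul (by positivity), Real.sqrt_sq hh]

theorem abs_coord_sub_le_dist (x y : EuclideanSpace ℝ (Fin n)) (i : Fin n) :
    |x i - y i| ≤ dist x y := by
  rw [dist_eq_norm]
  exact PiLp.norm_apply_le (x - y) i

theorem dist_le_of_mem_cube {a x y : EuclideanSpace ℝ (Fin n)} {l : ℝ} (hl : 0 ≤ l)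
    (hx : x ∈ cube a l) (hy : y ∈ cube a l) : dist x y ≤ √n * l := by
  refine dist_le_of_coord_le hl fun i => ?_
  have := hx i
  have := hy i
  rw [mem_Icc] at *
  rw [abs_le]
  constructor <;> linarith

/-- The translate of `x` by `-h` in every coordinate. It is the lower corner of the cube with
centre `x` and sidelength `2 * h`. -/
def corner (x : EuclideanSpace ℝ (Fin n)) (h : ℝ) : EuclideanSpace ℝ (Fin n) :=
  WithLp.toLp 2 fun i => x i - h

@[simp] theorem corner_apply (x : EuclideanSpace ℝ (Fin n)) (h : ℝ) (i : Fin n) :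
    corner x h i = x i - h := rfl

theorem mem_cube_corner {x y : EuclideanSpace ℝ (Fin n)} {h : ℝ} :
    y ∈ cube (corner x h) (2 * h) ↔ ∀ i, |y i - x i| ≤ h := by
  simp only [mem_cube, corner_apply, abs_le]
  refine forall_congr' fun i => ⟨fun H => ⟨by linarith [H.1], by linarith [H.2]⟩,
    fun H => ⟨by linarith [H.1], by linarith [H.2]⟩⟩

theorem cube_corner_subset_closedBall {x : EuclideanSpace ℝ (Fin n)} {h : ℝ} (hh : 0 ≤ h) :
    cube (corner x h) (2 * h) ⊆ Metric.closedBall x (√n * h) :=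
  fun _ hy => dist_le_of_coord_le hh (mem_cube_corner.1 hy)

theorem closedBall_subset_cube_corner {x : EuclideanSpace ℝ (Fin n)} {h : ℝ} :
    Metric.closedBall x h ⊆ cube (corner x h) (2 * h) :=
  fun y hy => mem_cube_corner.2 fun i => (abs_coord_sub_le_dist y x i).trans hy

theorem cube_corner_subset_cube_corner {x y : EuclideanSpace ℝ (Fin n)} {h k : ℝ}
    (H : dist x y + h ≤ k) : cube (corner x h) (2 * h) ⊆ cube (corner y k) (2 * k) := by
  intro z hz
  rw [mem_cube_corner] at hz ⊢
  intro i
  have h1 := abs_coord_sub_le_dist x y i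
  have h2 := hz i
  calc |z i - y i| ≤ |z i - x i| + |x i - y i| := abs_sub_le _ _ _
    _ ≤ k := by linarith

/-- Every cube is a cube around its centre. -/
theorem cube_eq_cube_corner (a : EuclideanSpace ℝ (Fin n)) (l : ℝ) :
    cube a l = cube (corner (corner a (-(l / 2))) (l / 2)) (2 * (l / 2)) := by
  have : corner (corner a (-(l / 2))) (l / 2) = a := by
    ext i
    simp
  rw [this, mul_div_cancel₀ _ (two_ne_zero)]

theorem center_mem_cube (a : EuclideanSpace ℝ (Fin n)) {l : ℝ} (hl : 0 ≤ l) :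
    corner a (-(l / 2)) ∈ cube a l := by
  intro i
  simp only [corner_apply, mem_Icc]
  constructor <;> linarith

theorem ball_center_subset_cube (a : EuclideanSpace ℝ (Fin n)) (l : ℝ) :
    Metric.ball (corner a (-(l / 2))) (l / 2) ⊆ cube a l := by
  rw [cube_eq_cube_corner]
  exact Metric.ball_subset_closedBall.trans closedBall_subset_cube_corner

theorem dist_center_le {a x : EuclideanSpace ℝ (Fin n)} {l : ℝ} (hl : 0 ≤ l)
    (hx : x ∈ cube a l) : dist x (corner a (-(l / 2))) ≤ √n * (l / 2) := by
  rw [cube_eq_cube_corner] at hx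
  exact cube_corner_subset_closedBall (by positivity) hx

/-! ### The boundary layer of a cube -/

/-- The points of a cube of sidelength `l` at distance less than `s * l` from its complement
make up at most the fraction `2 n s` of the cube. -/
theorem volume_boundary_layer_le (a : EuclideanSpace ℝ (Fin n)) {l s : ℝ} (hl : 0 < l)
    (hs : 0 ≤ s) :
    volume {x ∈ cube a l | ¬ Metric.ball x (s * l) ⊆ cube a l} ≤
      ENNReal.ofReal (2 * n * s) * volume (cube a l) := by
  rcases Nat.eq_zero_or_pos n with rfl | hn
  · have : {x ∈ cube a l | ¬ Metric.ball x (s * l) ⊆ cube a l} = ∅ := by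
      ext x
      simp only [mem_ofPred_eq, mem_empty_iff_false, iff_false, not_and, not_not]
      exact fun _ y _ i => i.elim0
    simp [this]
  have hn1 : (1 : ℝ) ≤ n := by exact_mod_cast hn
  rcases le_total (1 / 2) s with h | h
  · calc volume {x ∈ cube a l | ¬ Metric.ball x (s * l) ⊆ cube a l}
        ≤ 1 * volume (cube a l) := by
          rw [one_mul]
          exact measure_mono (sep_subset _ _)
      _ ≤ _ := by
          gcongr
          rw [ENNReal.one_le_ofReal]
          nlinarith
  have hsub : {x ∈ cube a l | ¬ Metric.ball x (s * l) ⊆ cube a l} ⊆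
      cube a l \ cube (corner a (-(s * l))) (l - 2 * (s * l)) := by
    rintro x ⟨hx, hx'⟩
    refine ⟨hx, fun hin => hx' fun y hy i => ?_⟩
    have h1 := hin i
    have h2 := (abs_coord_sub_le_dist y x i).trans hy.le
    rw [abs_le] at h2
    simp only [corner_apply, mem_Icc] at h1 ⊢
    constructor <;> linarith
  have hin : cube (corner a (-(s * l))) (l - 2 * (s * l)) ⊆ cube a l := by
    intro x hx i
    have h1 := hx i
    have : 0 ≤ s * l := by positivity
    simp only [corner_apply, mem_Icc] at h1 ⊢
    constructor <;> linarith
  refine (measure_mono hsub).trans ?_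
  have hpos : 0 ≤ l - 2 * (s * l) := by nlinarith
  rw [measure_sdiff hin (measurableSet_cube _ _).nullMeasurableSet (volume_cube_ne_top _ _),
    volume_cube, volume_cube, ← ENNReal.ofReal_pow hl.le, ← ENNReal.ofReal_pow hpos,
    ← ENNReal.ofReal_sub _ (by positivity), ← ENNReal.ofReal_mul (by positivity)]
  apply ENNReal.ofReal_le_ofReal
  have hb := one_add_mul_le_pow (a := -(2 * s)) (by linarith) n
  have : (l - 2 * (s * l)) ^ n = (1 + -(2 * s)) ^ n * l ^ n := by
    rw [← mul_pow]
    ring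
  rw [this]
  have hln : 0 ≤ l ^ n := by positivity
  nlinarith

/-- If `d` is at least the distance to the complement of the cube, the average over the cube of
`log⁺ (l / d)` is bounded by a constant that depends on the dimension only. -/
theorem setLAverage_posLog_div_le (a : EuclideanSpace ℝ (Fin n)) {l : ℝ} (hl : 0 < l)
    {d : EuclideanSpace ℝ (Fin n) → ℝ} (hd : Measurable d)
    (hball : ∀ x ∈ cube a l, ∀ r, 0 < r → Metric.ball x r ⊆ cube a l → r ≤ d x) :
    ⨍⁻ x in cube a l, ENNReal.ofReal (Real.posLog (l / d x)) ∂volume ≤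
      ENNReal.ofReal (2 * n) := by
  rw [setLAverage_eq]
  refine ENNReal.div_le_of_le_mul ?_
  rw [lintegral_eq_lintegral_meas_lt]
  rotate_left
  · exact Eventually.of_forall fun x => Real.posLog_nonneg
  · exact (Real.continuous_posLog.measurable.comp (measurable_const.div hd)).aemeasurable
  have key : ∀ s ∈ Ioi (0 : ℝ),
      (volume.restrict (cube a l)) {x | s < Real.posLog (l / d x)} ≤
        ENNReal.ofReal (2 * n) * volume (cube a l) * ENNReal.ofReal (Real.exp (-s)) := by
    intro s hs
    rw [mem_Ioi] at hs
    rw [Measure.restrict_apply' (measurableSet_cube _ _)]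
    calc volume ({x | s < Real.posLog (l / d x)} ∩ cube a l)
        ≤ volume {x ∈ cube a l | ¬ Metric.ball x (Real.exp (-s) * l) ⊆ cube a l} := by
          refine measure_mono ?_
          rintro x ⟨hx, hxQ⟩
          refine ⟨hxQ, fun hb => ?_⟩
          have h1 := hball x hxQ _ (by positivity) hb
          have hdpos : 0 < d x := lt_of_lt_of_le (by positivity) h1
          have h2 : l / d x ≤ Real.exp s := by
            rw [div_le_iff₀ hdpos]
            calc l = Real.exp s * (Real.exp (-s) * l) := by
                  rw [← mul_assoc, ← Real.exp_add]; simp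
              _ ≤ _ := by gcongr
          have h3 : Real.posLog (l / d x) ≤ s := by
            rw [Real.posLog_apply]
            refine max_le hs.le ?_
            calc Real.log (l / d x) ≤ Real.log (Real.exp s) :=
                  Real.log_le_log (by positivity) h2
              _ = s := Real.log_exp s
          exact absurd hx (not_lt.2 h3)
      _ ≤ ENNReal.ofReal (2 * n * Real.exp (-s)) * volume (cube a l) :=
          volume_boundary_layer_le a hl (Real.exp_pos _).le
      _ = _ := by
          rw [ENNReal.ofReal_mul (by positivity)]
          ring
  calc ∫⁻ s in Ioi (0 : ℝ), (volume.restrict (cube a l)) {x | s < Real.posLog (l / d x)}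
      ≤ ∫⁻ s in Ioi (0 : ℝ),
          ENNReal.ofReal (2 * n) * volume (cube a l) * ENNReal.ofReal (Real.exp (-s)) :=
        setLIntegral_mono' measurableSet_Ioi key
    _ = ENNReal.ofReal (2 * n) * volume (cube a l) * 1 := by
        rw [lintegral_const_mul _ (by fun_prop)]
        congr 1
        rw [← ofReal_integral_eq_lintegral_ofReal, integral_exp_neg_Ioi_zero, ENNReal.ofReal_one]
        · exact integrableOn_exp_neg_Ioi 0
        · exact Eventually.of_forall fun s => (Real.exp_pos _).le
    _ = _ := mul_one _

/-! ### Subdivision of a cube -/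

/-- The lower corners of the cubes of sidelength `τ` in the subdivision of the cube with lower
corner `a` into `m ^ n` cubes. -/
def cellCorner {m : ℕ} (a : EuclideanSpace ℝ (Fin n)) (τ : ℝ) (k : Fin n → Fin m) :
    EuclideanSpace ℝ (Fin n) :=
  WithLp.toLp 2 fun i => a i + k i * τ

@[simp] theorem cellCorner_apply {m : ℕ} (a : EuclideanSpace ℝ (Fin n)) (τ : ℝ)
    (k : Fin n → Fin m) (i : Fin n) : cellCorner a τ k i = a i + k i * τ := rfl

theorem cell_subset_cube {m : ℕ} (a : EuclideanSpace ℝ (Fin n)) {τ : ℝ} (hτ : 0 < τ)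
    (k : Fin n → Fin m) : cube (cellCorner a τ k) τ ⊆ cube a (m * τ) := by
  intro x hx i
  have h1 := hx i
  have h2 : ((k i : ℕ) : ℝ) + 1 ≤ m := by exact_mod_cast (k i).2
  have h3 : (0 : ℝ) ≤ (k i : ℕ) := by positivity
  simp only [cellCorner_apply, mem_Icc] at h1 ⊢
  constructor
  · nlinarith
  · nlinarith

theorem exists_mem_cell {m : ℕ} (hm : 0 < m) {a x : EuclideanSpace ℝ (Fin n)} {τ : ℝ}
    (hτ : 0 < τ) (hx : x ∈ cube a (m * τ)) :
    ∃ k : Fin n → Fin m, x ∈ cube (cellCorner a τ k) τ := by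
  refine ⟨fun i => ⟨min ⌊(x i - a i) / τ⌋₊ (m - 1), by omega⟩, fun i => ?_⟩
  have h1 := hx i
  rw [mem_Icc] at h1
  have h0 : 0 ≤ (x i - a i) / τ := div_nonneg (by linarith [h1.1]) hτ.le
  have h2 := Nat.floor_le h0
  have h3 := Nat.lt_floor_add_one ((x i - a i) / τ)
  rw [le_div_iff₀ hτ] at h2
  rw [div_lt_iff₀ hτ] at h3
  simp only [cellCorner_apply, mem_Icc]
  rcases le_total ⌊(x i - a i) / τ⌋₊ (m - 1) with h | h
  · rw [min_eq_left h]
    constructor <;> linarith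
  · rw [min_eq_right h]
    have h4 : ((m - 1 : ℕ) : ℝ) ≤ (⌊(x i - a i) / τ⌋₊ : ℝ) := by exact_mod_cast h
    have h5 : ((m - 1 : ℕ) : ℝ) = m - 1 := by
      rw [Nat.cast_sub hm]; simp
    constructor
    · nlinarith
    · rw [h5]
      linarith [h1.2]

/-- If `g` vanishes on the cube outside the cells with index in `S`, its average over the cube is
at most the proportion of these cells times a bound for the averages over them. -/
theorem setLAverage_cube_le_of_cells {m : ℕ} (a : EuclideanSpace ℝ (Fin n))
    {τ : ℝ} (hτ : 0 < τ) (S : Finset (Fin n → Fin m)) {g : EuclideanSpace ℝ (Fin n) → ℝ≥0∞}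
    (hS : ∀ x ∈ cube a (m * τ), g x ≠ 0 → ∃ k ∈ S, x ∈ cube (cellCorner a τ k) τ)
    {K : ℝ≥0∞} (hK : ∀ k ∈ S, ⨍⁻ x in cube (cellCorner a τ k) τ, g x ∂volume ≤ K) :
    ⨍⁻ x in cube a (m * τ), g x ∂volume ≤ (S.card : ℝ≥0∞) / (m : ℝ≥0∞) ^ n * K := by
  set U : Set (EuclideanSpace ℝ (Fin n)) := ⋃ k : S, cube (cellCorner a τ k.1) τ with hU
  have hUm : MeasurableSet U := MeasurableSet.iUnion fun k => measurableSet_cube _ _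
  have h1 : ∫⁻ x in cube a (m * τ), g x ≤ S.card * (ENNReal.ofReal τ ^ n * K) := by
    calc ∫⁻ x in cube a (m * τ), g x = ∫⁻ x in cube a (m * τ), U.indicator g x := by
          refine setLIntegral_congr_fun (measurableSet_cube _ _) fun x hx => ?_
          by_cases hg : g x = 0
          · by_cases hxU : x ∈ U
            · simp [hxU]
            · simp [hxU, hg]
          · obtain ⟨k, hk, hxk⟩ := hS x hx hg
            have : x ∈ U := mem_iUnion.2 ⟨⟨k, hk⟩, hxk⟩
            simp [this]
      _ = ∫⁻ x in U ∩ cube a (m * τ), g x := by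
          rw [lintegral_indicator hUm, Measure.restrict_restrict hUm]
      _ ≤ ∫⁻ x in U, g x := lintegral_mono_set inter_subset_left
      _ ≤ ∑' k : S, ∫⁻ x in cube (cellCorner a τ k.1) τ, g x := lintegral_iUnion_le _ _
      _ = ∑ k : S, ∫⁻ x in cube (cellCorner a τ k.1) τ, g x := tsum_fintype _
      _ ≤ ∑ _k : S, ENNReal.ofReal τ ^ n * K := by
          refine Finset.sum_le_sum fun k _ => ?_
          have := hK k.1 k.2
          rw [setLAverage_eq, volume_cube] at this
          rw [mul_comm]
          exact (ENNReal.div_le_iff_le_mul (Or.inl (pow_ne_zero _ (by simpa using hτ)))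
            (Or.inl (ENNReal.pow_ne_top ENNReal.ofReal_ne_top))).1 this
      _ = _ := by simp
  rw [setLAverage_eq, volume_cube]
  have hτ0 : ENNReal.ofReal τ ^ n ≠ 0 := pow_ne_zero _ (by simpa using hτ)
  have hτt : ENNReal.ofReal τ ^ n ≠ ∞ := ENNReal.pow_ne_top ENNReal.ofReal_ne_top
  rw [ENNReal.ofReal_mul (by positivity), ENNReal.ofReal_natCast, mul_pow]
  calc (∫⁻ x in cube a (m * τ), g x) / (m ^ n * ENNReal.ofReal τ ^ n)
      ≤ S.card * (ENNReal.ofReal τ ^ n * K) / (m ^ n * ENNReal.ofReal τ ^ n) := by gcongr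
    _ = (ENNReal.ofReal τ ^ n * (S.card * K)) / (ENNReal.ofReal τ ^ n * m ^ n) := by
        congr 1 <;> ring
    _ = (S.card * K) / m ^ n := ENNReal.mul_div_mul_left _ _ hτ0 hτt
    _ = _ := by
        rw [ENNReal.div_eq_inv_mul, ENNReal.div_eq_inv_mul]
        ring

theorem card_boundary_cells_le (m : ℕ) :
    (Finset.univ.filter fun k : Fin n → Fin m => ∃ i, (k i : ℕ) = 0 ∨ (k i : ℕ) + 1 = m).card ≤
      2 * n * m ^ (n - 1) := by
  rcases Nat.eq_zero_or_pos m with rfl | hm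
  · refine le_of_eq_of_le ?_ (Nat.zero_le _)
    rw [Finset.card_eq_zero, Finset.filter_eq_empty_iff]
    rintro k - ⟨i, -⟩
    exact (k i).elim0
  have hface : ∀ (i : Fin n) (c : Fin m),
      (Finset.univ.filter fun k : Fin n → Fin m => k i = c).card ≤ m ^ (n - 1) := by
    intro i c
    have : (Finset.univ.filter fun k : Fin n → Fin m => k i = c) ⊆
        Fintype.piFinset fun j => if j = i then {c} else Finset.univ := by
      intro k hk
      rw [Finset.mem_filter] at hk
      rw [Fintype.mem_piFinset]
      intro j
      by_cases hj : j = i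
      · subst hj; simp [hk.2]
      · simp [hj]
    refine (Finset.card_le_card this).trans ?_
    rw [Fintype.card_piFinset]
    rw [← Finset.mul_prod_erase Finset.univ _ (Finset.mem_univ i)]
    have h2 : ∀ j ∈ Finset.univ.erase i,
        (if j = i then ({c} : Finset (Fin m)) else Finset.univ).card = m := by
      intro j hj
      rw [if_neg (Finset.ne_of_mem_erase hj)]
      simp
    rw [Finset.prod_congr rfl h2, Finset.prod_const, Finset.card_erase_of_mem (Finset.mem_univ i)]
    simp
  have hsub : (Finset.univ.filter fun k : Fin n → Fin m =>
      ∃ i, (k i : ℕ) = 0 ∨ (k i : ℕ) + 1 = m) ⊆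
      Finset.univ.biUnion fun i : Fin n =>
        (Finset.univ.filter fun k : Fin n → Fin m => k i = ⟨0, hm⟩) ∪
        (Finset.univ.filter fun k : Fin n → Fin m => k i = ⟨m - 1, by omega⟩) := by
    intro k hk
    simp only [Finset.mem_filter, Finset.mem_univ, true_and, Finset.mem_biUnion,
      Finset.mem_union, Fin.ext_iff] at hk ⊢
    obtain ⟨i, hi⟩ := hk
    exact ⟨i, by omega⟩
  calc _ ≤ _ := Finset.card_le_card hsub
    _ ≤ ∑ i : Fin n, (m ^ (n - 1) + m ^ (n - 1)) := by
        refine Finset.card_biUnion_le.trans (Finset.sum_le_sum fun i _ => ?_)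
        exact (Finset.card_union_le _ _).trans (add_le_add (hface i _) (hface i _))
    _ = 2 * n * m ^ (n - 1) := by
        rw [Finset.sum_const, Finset.card_univ, Fintype.card_fin, smul_eq_mul]
        ring

/-- A point of a subdivided cube whose ball of radius `τ` leaves the cube lies in a boundary
cell. -/
theorem exists_mem_boundary_cell {m : ℕ} (hm : 0 < m) {a x : EuclideanSpace ℝ (Fin n)} {τ : ℝ}
    (hτ : 0 < τ) (hx : x ∈ cube a (m * τ)) (hb : ¬ Metric.ball x τ ⊆ cube a (m * τ)) :
    ∃ k ∈ Finset.univ.filter fun k : Fin n → Fin m => ∃ i, (k i : ℕ) = 0 ∨ (k i : ℕ) + 1 = m,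
      x ∈ cube (cellCorner a τ k) τ := by
  obtain ⟨k, hk⟩ := exists_mem_cell hm hτ hx
  refine ⟨k, ?_, hk⟩
  simp only [Finset.mem_filter, Finset.mem_univ, true_and]
  by_contra! hcon
  refine hb fun y hy i => ?_
  have h1 := hk i
  have h2 := (abs_coord_sub_le_dist y x i).trans hy.le
  have h3 : 1 ≤ (k i : ℕ) := Nat.one_le_iff_ne_zero.2 (hcon i).1
  have h4 : (k i : ℕ) + 2 ≤ m := by
    have := (k i).2
    have := (hcon i).2
    omega
  have h3' : (1 : ℝ) ≤ (k i : ℕ) := by exact_mod_cast h3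
  have h4' : ((k i : ℕ) : ℝ) + 2 ≤ m := by exact_mod_cast h4
  rw [abs_le] at h2
  simp only [cellCorner_apply, mem_Icc] at h1 ⊢
  constructor
  · nlinarith
  · nlinarith

end Cubes

/-! ### The norm of `bmo` -/

section Norm

variable {n : ℕ} {lam : ℝ} {Ω U : Set (EuclideanSpace ℝ (Fin n))}
  {f g : EuclideanSpace ℝ (Fin n) → ℝ}

theorem meanOsc_le_meanOscModulus {a : EuclideanSpace ℝ (Fin n)} {l : ℝ} (hl : 0 < l)
    (hlt : l < lam) (hQ : cube a l ⊆ Ω) :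
    ⨍⁻ x in cube a l, ‖f x - ⨍ y in cube a l, f y‖ₑ ∂volume ≤ meanOscModulus Ω f lam := by
  unfold meanOscModulus
  refine le_iSup_of_le a <| le_iSup_of_le l <| le_iSup_of_le hl <| le_iSup_of_le hlt <|
    le_iSup_of_le hQ ?_
  exact le_rfl

theorem average_le_largeCubeAverage {a : EuclideanSpace ℝ (Fin n)} {l : ℝ} (hl : 0 < l)
    (hlt : lam ≤ l) (hQ : cube a l ⊆ Ω) :
    ⨍⁻ x in cube a l, ‖f x‖ₑ ∂volume ≤ largeCubeAverage Ω f lam := by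
  unfold largeCubeAverage
  refine le_iSup_of_le a <| le_iSup_of_le l <| le_iSup_of_le hl <| le_iSup_of_le hlt <|
    le_iSup_of_le hQ ?_
  exact le_rfl

theorem meanOsc_le_bmoNorm {a : EuclideanSpace ℝ (Fin n)} {l : ℝ} (hl : 0 < l) (hlt : l < lam)
    (hQ : cube a l ⊆ Ω) :
    ⨍⁻ x in cube a l, ‖f x - ⨍ y in cube a l, f y‖ₑ ∂volume ≤ bmoNorm lam Ω f :=
  (meanOsc_le_meanOscModulus hl hlt hQ).trans le_self_add

theorem average_le_bmoNorm {a : EuclideanSpace ℝ (Fin n)} {l : ℝ} (hl : 0 < l) (hlt : lam ≤ l)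
    (hQ : cube a l ⊆ Ω) :
    ⨍⁻ x in cube a l, ‖f x‖ₑ ∂volume ≤ bmoNorm lam Ω f :=
  (average_le_largeCubeAverage hl hlt hQ).trans le_add_self

theorem bmoNorm_le {A B : ℝ≥0∞}
    (hA : ∀ (a : EuclideanSpace ℝ (Fin n)) (l : ℝ), 0 < l → l < lam → cube a l ⊆ Ω →
      ⨍⁻ x in cube a l, ‖f x - ⨍ y in cube a l, f y‖ₑ ∂volume ≤ A)
    (hB : ∀ (a : EuclideanSpace ℝ (Fin n)) (l : ℝ), 0 < l → lam ≤ l → cube a l ⊆ Ω →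
      ⨍⁻ x in cube a l, ‖f x‖ₑ ∂volume ≤ B) : bmoNorm lam Ω f ≤ A + B :=
  add_le_add
    (iSup₂_le fun a l => iSup₂_le fun h1 h2 => iSup_le fun h3 => hA a l h1 h2 h3)
    (iSup₂_le fun a l => iSup₂_le fun h1 h2 => iSup_le fun h3 => hB a l h1 h2 h3)

theorem bmoNorm_mono (h : U ⊆ Ω) : bmoNorm lam U f ≤ bmoNorm lam Ω f :=
  bmoNorm_le (fun _ _ h1 h2 h3 => meanOsc_le_meanOscModulus h1 h2 (h3.trans h))
    (fun _ _ h1 h2 h3 => average_le_largeCubeAverage h1 h2 (h3.trans h))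

theorem bmoNorm_neg : bmoNorm lam Ω (-f) = bmoNorm lam Ω f := by
  have h1 : ∀ (a : EuclideanSpace ℝ (Fin n)) (l : ℝ) (x : EuclideanSpace ℝ (Fin n)),
      ‖(-f) x - ⨍ y in cube a l, (-f) y‖ₑ = ‖f x - ⨍ y in cube a l, f y‖ₑ := by
    intro a l x
    simp only [Pi.neg_apply, average_neg]
    rw [← enorm_neg]
    congr 1
    ring
  simp only [bmoNorm, meanOscModulus, largeCubeAverage, h1]
  simp only [Pi.neg_apply, enorm_neg]

/-- On a cube of any size, the mean oscillation is at most twice the norm. -/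
theorem meanOsc_le_two_mul_bmoNorm {a : EuclideanSpace ℝ (Fin n)} {l : ℝ} (hl : 0 < l)
    (hQ : cube a l ⊆ Ω) (hf : IntegrableOn f (cube a l)) :
    ⨍⁻ x in cube a l, ‖f x - ⨍ y in cube a l, f y‖ₑ ∂volume ≤ 2 * bmoNorm lam Ω f := by
  rcases lt_or_ge l lam with h | h
  · refine (meanOsc_le_bmoNorm hl h hQ).trans ?_
    rw [two_mul]
    exact le_self_add
  · refine (meanOsc_le_two_mul (volume_cube_ne_zero a hl) (volume_cube_ne_top a l) hf 0).trans ?_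
    simp only [sub_zero]
    gcongr
    exact average_le_bmoNorm hl h hQ

theorem setLAverage_add_le {α : Type*} [MeasurableSpace α] {μ : Measure α} {s : Set α}
    {u v w : α → ℝ≥0∞} (hu : AEMeasurable u (μ.restrict s)) (h : ∀ x, w x ≤ u x + v x) :
    ⨍⁻ x in s, w x ∂μ ≤ (⨍⁻ x in s, u x ∂μ) + ⨍⁻ x in s, v x ∂μ := by
  calc ⨍⁻ x in s, w x ∂μ ≤ ⨍⁻ x in s, (u x + v x) ∂μ :=
        laverage_mono_ae (Eventually.of_forall h)
    _ = _ := by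
        rw [setLAverage_eq, setLAverage_eq, setLAverage_eq, lintegral_add_left' hu,
          ENNReal.add_div]

theorem bmoNorm_sub_le
    (hf : ∀ (a : EuclideanSpace ℝ (Fin n)) (l : ℝ), 0 < l → cube a l ⊆ Ω →
      IntegrableOn f (cube a l))
    (hg : ∀ (a : EuclideanSpace ℝ (Fin n)) (l : ℝ), 0 < l → cube a l ⊆ Ω →
      IntegrableOn g (cube a l)) :
    bmoNorm lam Ω (f - g) ≤ bmoNorm lam Ω f + bmoNorm lam Ω g := by
  have : bmoNorm lam Ω f + bmoNorm lam Ω g =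
      (meanOscModulus Ω f lam + meanOscModulus Ω g lam) +
        (largeCubeAverage Ω f lam + largeCubeAverage Ω g lam) := by
    simp only [bmoNorm]
    ring
  rw [this]
  refine bmoNorm_le (fun a l h1 h2 h3 => ?_) (fun a l h1 h2 h3 => ?_)
  · have hfi := hf a l h1 h3
    have hgi := hg a l h1 h3
    have havg : ⨍ y in cube a l, (f - g) y = (⨍ y in cube a l, f y) - ⨍ y in cube a l, g y := by
      rw [average_eq', average_eq', average_eq', ← integral_sub hfi.to_average hgi.to_average]
      rfl
    refine (setLAverage_add_le
      (u := fun x => ‖f x - ⨍ y in cube a l, f y‖ₑ)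
      (v := fun x => ‖g x - ⨍ y in cube a l, g y‖ₑ) ?_ fun x => ?_).trans ?_
    · exact (hfi.aestronglyMeasurable.sub aestronglyMeasurable_const).enorm
    · rw [havg, Pi.sub_apply]
      have : f x - g x - ((⨍ y in cube a l, f y) - ⨍ y in cube a l, g y) =
        (f x - ⨍ y in cube a l, f y) - (g x - ⨍ y in cube a l, g y) := by ring
      rw [this]
      exact enorm_sub_le
    · exact add_le_add (meanOsc_le_meanOscModulus h1 h2 h3) (meanOsc_le_meanOscModulus h1 h2 h3)
  · have hfi := hf a l h1 h3
    refine (setLAverage_add_le (u := fun x => ‖f x‖ₑ) (v := fun x => ‖g x‖ₑ)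
      hfi.aestronglyMeasurable.enorm fun x => enorm_sub_le).trans ?_
    exact add_le_add (average_le_largeCubeAverage h1 h2 h3) (average_le_largeCubeAverage h1 h2 h3)

theorem bmoNorm_eq_zero_of_null (h : volume (U ∩ Function.support f) = 0) :
    bmoNorm lam U f = 0 := by
  have hae : ∀ (a : EuclideanSpace ℝ (Fin n)) (l : ℝ), cube a l ⊆ U →
      f =ᵐ[volume.restrict (cube a l)] 0 := by
    intro a l hQ
    rw [Filter.EventuallyEq, ae_restrict_iff' (measurableSet_cube a l), ae_iff]
    refine measure_mono_null ?_ h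
    intro x hx
    simp only [mem_ofPred_eq, Classical.not_imp] at hx
    exact ⟨hQ hx.1, hx.2⟩
  rw [← nonpos_iff_eq_zero, ← add_zero (0 : ℝ≥0∞)]
  refine bmoNorm_le (fun a l h1 h2 h3 => ?_) (fun a l h1 h2 h3 => ?_)
  · have havg : ⨍ y in cube a l, f y = 0 := by
      rw [average_congr (hae a l h3)]
      simp
    rw [havg, laverage_congr (g := fun _ => 0)]
    · simp
    · filter_upwards [hae a l h3] with x hx
      simp [hx]
  · rw [laverage_congr (g := fun _ => 0)]
    · simp
    · filter_upwards [hae a l h3] with x hx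
      simp [hx]

theorem abs_average_sub_average_le {B : ℝ} (hB : 0 ≤ B) {a b : EuclideanSpace ℝ (Fin n)}
    {l k : ℝ} (hl : 0 < l) (hk : 0 < k) (hsub : cube a l ⊆ cube b k)
    (hf : IntegrableOn f (cube b k))
    (hosc : ⨍⁻ x in cube b k, ‖f x - ⨍ y in cube b k, f y‖ₑ ∂volume ≤ ENNReal.ofReal B) :
    |(⨍ y in cube a l, f y) - ⨍ y in cube b k, f y| ≤ (k / l) ^ n * B := by
  have h1 := enorm_setAverage_sub_le (volume_cube_ne_zero a hl) (volume_cube_ne_top a l)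
    (hf.mono_set hsub) (⨍ y in cube b k, f y)
  have h2 := setLAverage_le_of_subset (volume_cube_ne_zero b hk) (volume_cube_ne_top b k) hsub
    (fun x => ‖f x - ⨍ y in cube b k, f y‖ₑ)
  rw [volume_cube_div b a hk.le hl] at h2
  have h3 : ‖(⨍ y in cube a l, f y) - ⨍ y in cube b k, f y‖ₑ ≤
      ENNReal.ofReal ((k / l) ^ n * B) := by
    rw [ENNReal.ofReal_mul (by positivity)]
    refine h1.trans (h2.trans ?_)
    gcongr
  rwa [Real.enorm_eq_ofReal_abs, ENNReal.ofReal_le_ofReal_iff (by positivity)] at h3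

end Norm

/-! ### Chains along curves -/

section Chains

/-- Greedy grouping: along a chain with steps of size at most `ρ`, a function that varies by at
most `K` between points of the chain at distance at most `ρ` varies between the ends by at most a
multiple of `K` controlled by the length of the chain in units of `ρ`. -/
theorem abs_sub_le_of_chain {X : Type*} [PseudoMetricSpace X] (p : ℕ → X) (u : ℕ → ℝ) {ρ K : ℝ}
    (hρ : 0 < ρ) (hK : 0 ≤ K) (hstep : ∀ i, dist (p i) (p (i + 1)) ≤ ρ)
    (hu : ∀ i j, dist (p i) (p j) ≤ ρ → |u i - u j| ≤ K) (N : ℕ) : ∀ k,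
    |u k - u (k + N)| ≤
      K * (1 + 2 * ((∑ i ∈ Finset.range N, dist (p (k + i)) (p (k + i + 1))) / ρ)) := by
  induction N using Nat.strong_induction_on with
  | _ N ih =>
    intro k
    by_cases hall : ∀ j ≤ N, dist (p k) (p (k + j)) ≤ ρ
    · refine (hu _ _ (hall N le_rfl)).trans (le_mul_of_one_le_right hK ?_)
      have : 0 ≤ (∑ i ∈ Finset.range N, dist (p (k + i)) (p (k + i + 1))) / ρ := by positivity
      linarith
    · push Not at hall
      classical
      obtain ⟨hjN, hj⟩ := Nat.find_spec hall
      have hmin : ∀ i, i < Nat.find hall → ¬ (i ≤ N ∧ ρ < dist (p k) (p (k + i))) :=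
        fun i hi => Nat.find_min hall hi
      generalize Nat.find hall = j at hjN hj hmin
      have hj0 : 0 < j := by
        rcases Nat.eq_zero_or_pos j with rfl | h
        · simp at hj; linarith
        · exact h
      obtain ⟨i, rfl⟩ : ∃ i, j = i + 1 := ⟨j - 1, by omega⟩
      have h1 : dist (p k) (p (k + i)) ≤ ρ := by
        by_contra hcon
        exact hmin i (by omega) ⟨by omega, not_le.1 hcon⟩
      have h2 : |u k - u (k + (i + 1))| ≤ 2 * K :=
        calc |u k - u (k + (i + 1))| ≤ |u k - u (k + i)| + |u (k + i) - u (k + (i + 1))| :=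
              abs_sub_le _ _ _
          _ ≤ K + K := add_le_add (hu _ _ h1) (hu _ _ (hstep _))
          _ = 2 * K := by ring
      obtain ⟨N', rfl⟩ : ∃ N', N = i + 1 + N' := ⟨N - (i + 1), by omega⟩
      have h3 := ih N' (by omega) (k + (i + 1))
      have h4 : ρ ≤ ∑ q ∈ Finset.range (i + 1), dist (p (k + q)) (p (k + q + 1)) :=
        hj.le.trans (dist_le_range_sum_dist (fun q => p (k + q)) (i + 1))
      rw [Finset.sum_range_add]
      have h5 : ∀ q, k + (i + 1 + q) = k + (i + 1) + q := fun q => by ring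
      simp only [h5]
      set S1 := ∑ q ∈ Finset.range (i + 1), dist (p (k + q)) (p (k + q + 1))
      set S2 := ∑ q ∈ Finset.range N', dist (p (k + (i + 1) + q)) (p (k + (i + 1) + q + 1))
      have h6 : 1 ≤ S1 / ρ := by rwa [le_div_iff₀ hρ, one_mul]
      calc |u k - u (k + (i + 1) + N')|
          ≤ |u k - u (k + (i + 1))| + |u (k + (i + 1)) - u (k + (i + 1) + N')| :=
            abs_sub_le _ _ _
        _ ≤ 2 * K + K * (1 + 2 * (S2 / ρ)) := add_le_add h2 h3
        _ ≤ K * (1 + 2 * ((S1 + S2) / ρ)) := by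
            rw [add_div]
            nlinarith

theorem abs_sub_le_of_path {X : Type*} [PseudoMetricSpace X] {x y : X} (γ : Path x y) (u : X → ℝ)
    {ρ K L : ℝ} (hρ : 0 < ρ) (hK : 0 ≤ K) (hL : 0 ≤ L)
    (hvar : eVariationOn γ univ ≤ ENNReal.ofReal L)
    (hu : ∀ s t, dist (γ s) (γ t) ≤ ρ → |u (γ s) - u (γ t)| ≤ K) :
    |u x - u y| ≤ K * (1 + 2 * (L / ρ)) := by
  obtain ⟨θ, hθ, hθ'⟩ := Metric.uniformContinuous_iff.1
    (CompactSpace.uniformContinuous_of_continuous γ.continuous) ρ hρ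
  obtain ⟨N, hN⟩ := exists_nat_one_div_lt hθ
  have hN0 : (0 : ℝ) < N + 1 := by positivity
  let q : ℕ → unitInterval := fun i => Set.projIcc (0 : ℝ) 1 zero_le_one (i / (N + 1))
  have hq : Monotone q := by
    intro i j hij
    refine Set.monotone_projIcc _ ?_
    gcongr
  have hqstep : ∀ i, dist (γ (q i)) (γ (q (i + 1))) ≤ ρ := by
    intro i
    refine (hθ' ?_).le
    refine lt_of_le_of_lt ?_ hN
    rw [Subtype.dist_eq, Real.dist_eq]
    refine (Set.abs_projIcc_sub_projIcc zero_le_one).trans ?_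
    rw [← sub_div]
    push_cast
    rw [show (i : ℝ) - (i + 1) = -1 by ring, abs_div, abs_neg, abs_one, abs_of_pos hN0]
  have h := abs_sub_le_of_chain (fun i => γ (q i)) (fun i => u (γ (q i))) hρ hK hqstep
    (fun i j => hu _ _) (N + 1) 0
  have hq0 : q 0 = 0 := by
    simp [q, Set.projIcc_of_le_left]
  have hqN : q (0 + (N + 1)) = 1 := by
    have : ((N + 1 : ℕ) : ℝ) / (N + 1) = 1 := by
      push_cast
      exact div_self hN0.ne'
    simp only [q, zero_add, this]
    exact Set.projIcc_of_right_le _ le_rfl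
  simp only [hq0, hqN, γ.source, γ.target] at h
  refine h.trans ?_
  gcongr
  have hs := eVariationOn.sum_le (f := γ) (s := univ) (n := N + 1) hq (fun i => mem_univ _)
  have hs' := hs.trans hvar
  simp only [edist_dist] at hs'
  rw [← ENNReal.ofReal_sum_of_nonneg (fun _ _ => dist_nonneg),
    ENNReal.ofReal_le_ofReal_iff hL] at hs'
  refine le_trans (le_of_eq ?_) hs'
  refine Finset.sum_congr rfl fun i _ => ?_
  rw [zero_add, dist_comm]

end Chains

/-! ### Logarithmic growth of averages over small cubes -/

section Growth

variable {n : ℕ} {ε δ : ℝ} {Ω : Set (EuclideanSpace ℝ (Fin n))} {f : EuclideanSpace ℝ (Fin n) → ℝ}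

theorem ball_subset_of_le_infEDist_frontier {z : EuclideanSpace ℝ (Fin n)} {r : ℝ} (hz : z ∈ Ω)
    (h : ENNReal.ofReal r ≤ Metric.infEDist z (frontier Ω)) : Metric.ball z r ⊆ Ω := by
  intro w hw
  by_contra hwΩ
  obtain ⟨v, hvf, hv⟩ := exists_mem_frontier_infDist_compl_eq_dist hz
    (ne_univ_iff_exists_notMem Ω |>.2 ⟨w, hwΩ⟩)
  have h1 := h.trans (Metric.infEDist_le_edist_of_mem hvf)
  rw [edist_dist, ENNReal.ofReal_le_ofReal_iff dist_nonneg, ← hv] at h1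
  have h2 := h1.trans (Metric.infDist_le_dist_of_mem (mem_compl hwΩ))
  rw [dist_comm] at h2
  exact absurd hw (not_lt.2 h2)

/-- `f` is integrable on every cube in `Ω`, with mean oscillation at most `B`. -/
def HasMeanOscLE (Ω : Set (EuclideanSpace ℝ (Fin n))) (f : EuclideanSpace ℝ (Fin n) → ℝ)
    (B : ℝ) : Prop :=
  ∀ (a : EuclideanSpace ℝ (Fin n)) (l : ℝ), 0 < l → cube a l ⊆ Ω → IntegrableOn f (cube a l) ∧
    ⨍⁻ x in cube a l, ‖f x - ⨍ y in cube a l, f y‖ₑ ∂volume ≤ ENNReal.ofReal B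

/-- The average of `f` over the cube with centre `x` and sidelength `2 * h`. -/
noncomputable def centeredAverage (f : EuclideanSpace ℝ (Fin n) → ℝ)
    (x : EuclideanSpace ℝ (Fin n)) (h : ℝ) : ℝ :=
  ⨍ y in cube (corner x h) (2 * h), f y

theorem HasMeanOscLE.abs_centeredAverage_sub_le {B : ℝ} (H : HasMeanOscLE Ω f B) (hB : 0 ≤ B)
    {x y : EuclideanSpace ℝ (Fin n)} {h k : ℝ} (hh : 0 < h) (hxy : dist x y + h ≤ k)
    (hk : cube (corner y k) (2 * k) ⊆ Ω) :
    |centeredAverage f x h - centeredAverage f y k| ≤ (k / h) ^ n * B := by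
  have hk0 : 0 < k := by linarith [dist_nonneg (x := x) (y := y)]
  obtain ⟨h1, h2⟩ := H _ _ (by positivity) hk
  have := abs_average_sub_average_le hB (by positivity : 0 < 2 * h) (by positivity : 0 < 2 * k)
    (cube_corner_subset_cube_corner hxy) h1 h2
  rwa [mul_div_mul_left _ _ (two_ne_zero)] at this

theorem cube_corner_subset_ball (hn : 1 ≤ n) {x : EuclideanSpace ℝ (Fin n)} {r h : ℝ}
    (hr : 0 < r) (hh : 0 ≤ h) (hhr : h ≤ r / (2 * √n)) :
    cube (corner x h) (2 * h) ⊆ Metric.ball x r := by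
  have hn' : 0 < √(n : ℝ) := Real.sqrt_pos.2 (by exact_mod_cast hn)
  refine (cube_corner_subset_closedBall hh).trans (Metric.closedBall_subset_ball ?_)
  calc √n * h ≤ √n * (r / (2 * √n)) := by gcongr
    _ = r / 2 := by field_simp
    _ < r := by linarith

/-- Averages over cubes around two points that are far from the boundary at scale `r`, and at
distance comparable to `r`, differ by a bounded amount: the curve that joins the points stays far
from the boundary, and its length bounds the number of cubes needed to follow it. -/
theorem IsEpsDeltaDomain.exists_abs_centeredAverage_sub_le (hΩ : IsEpsDeltaDomain ε δ Ω)
    (hn : 1 ≤ n) {B : ℝ} (H : HasMeanOscLE Ω f B) (hB : 0 ≤ B) {A : ℝ} (hA : 1 ≤ A) :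
    ∃ K : ℝ, 0 ≤ K ∧ ∀ (r : ℝ) (x y : EuclideanSpace ℝ (Fin n)), 0 < r → Metric.ball x r ⊆ Ω →
      Metric.ball y r ⊆ Ω → dist x y ≤ A * r → dist x y < δ →
      |centeredAverage f x (r / (2 * √n)) - centeredAverage f y (r / (2 * √n))| ≤ K := by
  have hn' : 0 < √(n : ℝ) := Real.sqrt_pos.2 (by exact_mod_cast hn)
  have hε := hΩ.eps_pos
  have hε1 := hΩ.eps_le_one
  have hA0 : 0 < A := by linarith
  -- on a curve between the two points, the distance to the boundary is at least `c * r`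
  obtain ⟨c, hc⟩ : ∃ c, c = ε / (4 * A) := ⟨_, rfl⟩
  have hc0 : 0 < c := by rw [hc]; positivity
  have hc4 : c ≤ 1 / 4 := by
    rw [hc, div_le_iff₀ (by positivity)]
    linarith
  refine ⟨(2 ^ n * B + 2 ^ n * B) * (1 + 2 * (4 * √n * A / (ε * c))) +
    2 * ((2 / c) ^ n * B), by positivity, ?_⟩
  intro r x y hr hx hy hxy hδ
  rcases eq_or_ne x y with rfl | hne
  · rw [sub_self, abs_zero]
    positivity
  have hxΩ : x ∈ Ω := hx (Metric.mem_ball_self hr)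
  have hyΩ : y ∈ Ω := hy (Metric.mem_ball_self hr)
  have hd : 0 < dist x y := dist_pos.2 hne
  obtain ⟨γ, hγΩ, hγL, hγd⟩ := hΩ.exists_curve x hxΩ y hyΩ hne hδ
  have hball : ∀ s, Metric.ball (γ s) (c * r) ⊆ Ω := by
    intro s
    have hcr : c * r ≤ r / 2 := by nlinarith
    rcases lt_or_ge (dist (γ s) x) (r / 2) with h | h
    · exact (Metric.ball_subset_ball' (by linarith)).trans hx
    rcases lt_or_ge (dist (γ s) y) (r / 2) with h' | h'
    · exact (Metric.ball_subset_ball' (by linarith)).trans hy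
    refine ball_subset_of_le_infEDist_frontier (hγΩ s)
      (le_trans (ENNReal.ofReal_le_ofReal ?_) (hγd s))
    have h1 : (r / 2) * (r / 2) ≤ dist (γ s) x * dist (γ s) y := by gcongr
    calc c * r = ε * ((r / 2) * (r / 2) / (A * r)) := by
          rw [hc]; field_simp; ring
      _ ≤ ε * (dist (γ s) x * dist (γ s) y / dist x y) := by gcongr
  -- the cubes of sidelength `4 * h` around points of the curve lie in `Ω`, and contain those of
  -- sidelength `2 * h` around nearby points
  obtain ⟨h, hh⟩ : ∃ h, h = c * r / (4 * √n) := ⟨_, rfl⟩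
  have hh0 : 0 < h := by rw [hh]; positivity
  have hcube : ∀ s, cube (corner (γ s) (2 * h)) (2 * (2 * h)) ⊆ Ω := by
    intro s
    refine (cube_corner_subset_ball hn (r := c * r) (by positivity) (by positivity) ?_).trans
      (hball s)
    rw [hh]
    apply le_of_eq
    field_simp
    norm_num
  have hpath := abs_sub_le_of_path γ (fun z => centeredAverage f z h) hh0
    (by positivity : 0 ≤ 2 ^ n * B + 2 ^ n * B) (by positivity : 0 ≤ ε⁻¹ * dist x y) hγL ?_
  · have hends : ∀ z, Metric.ball z r ⊆ Ω →
        |centeredAverage f z h - centeredAverage f z (r / (2 * √n))| ≤ (2 / c) ^ n * B := by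
      intro z hz
      have h1 := H.abs_centeredAverage_sub_le hB (x := z) (y := z) (k := r / (2 * √n)) hh0 ?_
        ((cube_corner_subset_ball hn hr (by positivity) le_rfl).trans hz)
      · refine h1.trans (le_of_eq ?_)
        congr 2
        rw [hh]
        field_simp
        norm_num
      · rw [dist_self, zero_add, hh, div_le_div_iff₀ (by positivity) (by positivity)]
        nlinarith [mul_pos hr hn']
    have h1 := hends x hx
    have h2 := hends y hy
    have h3 : (2 ^ n * B + 2 ^ n * B) * (1 + 2 * (ε⁻¹ * dist x y / h)) ≤
        (2 ^ n * B + 2 ^ n * B) * (1 + 2 * (4 * √n * A / (ε * c))) := by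
      gcongr (2 ^ n * B + 2 ^ n * B) * (1 + 2 * ?_)
      calc ε⁻¹ * dist x y / h ≤ ε⁻¹ * (A * r) / h := by gcongr
        _ = _ := by
          rw [hh]
          field_simp
    rw [abs_le] at *
    constructor <;> linarith
  · intro s t hst
    have h1 := H.abs_centeredAverage_sub_le hB (x := γ s) (y := γ s) (k := 2 * h) hh0
      (by rw [dist_self]; linarith) (hcube s)
    have h2 := H.abs_centeredAverage_sub_le hB (x := γ t) (y := γ s) (k := 2 * h) hh0
      (by rw [dist_comm]; linarith) (hcube s)
    rw [mul_div_cancel_right₀ _ hh0.ne'] at h1 h2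
    rw [abs_le] at *
    constructor <;> linarith

/-- From a point with a ball of radius `r` in `Ω` one can move, over a distance comparable to `r`,
to a point with a ball of radius `2 * r` in `Ω`, unless `Ω` is small: such a point lies on the curve
to a point at distance `8 * r / ε`. -/
theorem IsEpsDeltaDomain.exists_ball_two_mul_subset (hΩ : IsEpsDeltaDomain ε δ Ω)
    {x y : EuclideanSpace ℝ (Fin n)} {r : ℝ} (hr : 0 < r) (hx : x ∈ Ω) (hrδ : 8 * r / ε < δ)
    (hy : y ∈ Ω) (hxy : 8 * r / ε ≤ dist x y) :
    ∃ z, Metric.ball z (2 * r) ⊆ Ω ∧ dist x z = 4 * r / ε := by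
  have hε := hΩ.eps_pos
  have h8 : 0 < 8 * r / ε := by positivity
  have h48 : 8 * r / ε = 4 * r / ε + 4 * r / ε := by ring
  have h4 : 0 < 4 * r / ε := by positivity
  obtain ⟨w, hwΩ, hw⟩ : 8 * r / ε ∈ (fun w => dist x w) '' Ω := by
    refine hΩ.isConnected.isPreconnected.intermediate_value hx hy
      (Continuous.continuousOn (by fun_prop)) ⟨?_, hxy⟩
    simpa using h8.le
  simp only at hw
  have hne : x ≠ w := by
    rintro rfl
    simp at hw
    linarith
  obtain ⟨γ, hγΩ, -, hγd⟩ := hΩ.exists_curve x hx w hwΩ hne (by rw [hw]; exact hrδ)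
  obtain ⟨s, -, hs⟩ : 4 * r / ε ∈ (fun s => dist x (γ s)) '' (univ : Set unitInterval) := by
    refine isPreconnected_univ.intermediate_value (mem_univ 0) (mem_univ 1)
      (Continuous.continuousOn (by fun_prop)) ⟨?_, ?_⟩
    · simpa using h4.le
    · simp only [γ.target]
      rw [hw]
      linarith
  simp only at hs
  refine ⟨γ s, ball_subset_of_le_infEDist_frontier (hγΩ s)
    (le_trans (ENNReal.ofReal_le_ofReal ?_) (hγd s)), hs⟩
  have h1 : dist (γ s) x = 4 * r / ε := by rw [dist_comm, hs]
  have h2 : 4 * r / ε ≤ dist (γ s) w := by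
    have := dist_triangle x (γ s) w
    linarith
  rw [h1, hw]
  calc 2 * r = ε * (4 * r / ε * (4 * r / ε) / (8 * r / ε)) := by
        field_simp
        norm_num
    _ ≤ _ := by gcongr

theorem naturalScale_pos (hn : 1 ≤ n) (hε : 0 < ε) (hδ : 0 < δ) : 0 < naturalScale n ε δ := by
  have : (0 : ℝ) < n := by exact_mod_cast hn
  unfold naturalScale
  positivity

theorem eight_mul_naturalScale_lt (hn : 1 ≤ n) (hΩ : IsEpsDeltaDomain ε δ Ω) :
    8 * (√n * naturalScale n ε δ) / ε < δ := by
  have hε := hΩ.eps_pos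
  have hε1 := hΩ.eps_le_one
  have hδ := hΩ.delta_pos
  have hn1 : (1 : ℝ) ≤ n := by exact_mod_cast hn
  have hs : √(n : ℝ) ≤ n := by
    rw [Real.sqrt_le_left (by positivity)]
    nlinarith
  have hs0 : 0 < √(n : ℝ) := Real.sqrt_pos.2 (by linarith)
  unfold naturalScale
  rw [div_lt_iff₀ hε, ← mul_assoc, mul_div_assoc', div_lt_iff₀ (by positivity)]
  have h1 : 8 * √n * (ε ^ 2 * δ) ≤ 8 * n * (ε * δ) := by
    have : ε ^ 2 ≤ ε := by nlinarith
    gcongr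
  have h2 : 0 < ε * δ * n := by positivity
  have h3 : 0 < ε * δ * n * (√n * ε) := by positivity
  nlinarith

theorem abs_average_le_of_average_le {a : EuclideanSpace ℝ (Fin n)} {l B : ℝ} (hl : 0 < l)
    (hB : 0 ≤ B) (hf : IntegrableOn f (cube a l))
    (h : ⨍⁻ x in cube a l, ‖f x‖ₑ ∂volume ≤ ENNReal.ofReal B) :
    |⨍ x in cube a l, f x| ≤ B := by
  have h1 := enorm_setAverage_sub_le (volume_cube_ne_zero a hl) (volume_cube_ne_top a l) hf 0
  simp only [sub_zero] at h1
  have h2 := h1.trans h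
  rwa [Real.enorm_eq_ofReal_abs, ENNReal.ofReal_le_ofReal_iff hB] at h2

/-- Logarithmic growth in dyadic form. By induction on `k`, a point with a ball of radius
`r = ρ / 2 ^ k` in `Ω` is moved to one with a ball of radius `2 * r`, at bounded cost; if `Ω` is too
small for this, `r` is bounded below and the point is connected to a fixed point of `Ω` instead. -/
theorem IsEpsDeltaDomain.exists_abs_centeredAverage_le (hΩ : IsEpsDeltaDomain ε δ Ω)
    (hn : 1 ≤ n) {B : ℝ} (H : HasMeanOscLE Ω f B) (hB : 0 ≤ B)
    (Hlarge : ∀ (a : EuclideanSpace ℝ (Fin n)) (l : ℝ), 0 < l → naturalScale n ε δ ≤ l →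
      cube a l ⊆ Ω → ⨍⁻ x in cube a l, ‖f x‖ₑ ∂volume ≤ ENNReal.ofReal B) :
    ∃ M : ℝ, 0 ≤ M ∧ ∀ (k : ℕ) (x : EuclideanSpace ℝ (Fin n)),
      Metric.ball x (√n * naturalScale n ε δ / 2 ^ k) ⊆ Ω →
      |centeredAverage f x (√n * naturalScale n ε δ / 2 ^ k / (2 * √n))| ≤ M * (1 + k) := by
  have hε := hΩ.eps_pos
  have hε1 := hΩ.eps_le_one
  have hδ := hΩ.delta_pos
  have hn' : 0 < √(n : ℝ) := Real.sqrt_pos.2 (by exact_mod_cast hn)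
  have hlam := naturalScale_pos hn hε hδ
  have hρδ := eight_mul_naturalScale_lt hn hΩ
  obtain ⟨ρ, hρ⟩ : ∃ ρ, ρ = √n * naturalScale n ε δ := ⟨_, rfl⟩
  rw [← hρ] at hρδ ⊢
  have hρ0 : 0 < ρ := by rw [hρ]; positivity
  -- two distinct points of `Ω`; balls that contain both of them are not too small
  obtain ⟨x₀, hx₀⟩ := hΩ.isConnected.nonempty
  obtain ⟨r₀, hr₀, hr₀Ω⟩ := Metric.isOpen_iff.1 hΩ.isOpen x₀ hx₀
  obtain ⟨x₁, hx₁, hne⟩ : ∃ x₁ ∈ Ω, x₀ ≠ x₁ := by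
    refine ⟨x₀ + EuclideanSpace.single ⟨0, hn⟩ (r₀ / 2), hr₀Ω ?_, ?_⟩
    · rw [Metric.mem_ball, dist_eq_norm, add_sub_cancel_left, PiLp.norm_single,
        Real.norm_of_nonneg (by positivity)]
      linarith
    · intro h
      have h1 : dist x₀ (x₀ + EuclideanSpace.single ⟨0, hn⟩ (r₀ / 2)) = 0 := by
        rw [← h, dist_self]
      rw [dist_comm, dist_eq_norm, add_sub_cancel_left, PiLp.norm_single,
        Real.norm_of_nonneg (by positivity)] at h1
      linarith
  obtain ⟨r₂, hr₂⟩ : ∃ r₂, r₂ = min r₀ (min ρ (ε * dist x₀ x₁ / 16)) := ⟨_, rfl⟩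
  have hd : 0 < dist x₀ x₁ := dist_pos.2 hne
  have hr₂0 : 0 < r₂ := by rw [hr₂]; positivity
  have hr₂ρ : r₂ ≤ ρ := by rw [hr₂]; exact (min_le_right _ _).trans (min_le_left _ _)
  have hr₂d : r₂ ≤ ε * dist x₀ x₁ / 16 := by
    rw [hr₂]; exact (min_le_right _ _).trans (min_le_right _ _)
  have hr₂r₀ : r₂ ≤ r₀ := by rw [hr₂]; exact min_le_left _ _
  obtain ⟨K₁, hK₁, hup⟩ := hΩ.exists_abs_centeredAverage_sub_le hn H hB (A := 4 / ε)
    (by rw [le_div_iff₀ hε]; linarith)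
  -- if `Ω` lies in the ball of radius `8 * r / ε ≤ 8 * ρ / ε` around `x`, the points `x` and `x₀`
  -- are connected at the fixed scale `r₂`
  obtain ⟨K₂, hK₂, hconn⟩ := hΩ.exists_abs_centeredAverage_sub_le hn H hB
    (A := 8 * ρ / (ε * r₂)) (by rw [le_div_iff₀ (by positivity)]; nlinarith)
  obtain ⟨M, hM⟩ : ∃ M, M = B + (K₁ + 2 ^ n * B) +
    (K₂ + |centeredAverage f x₀ (r₂ / (2 * √n))| + (ρ / r₂) ^ n * B) := ⟨_, rfl⟩
  have hM1 : B + (K₁ + 2 ^ n * B) ≤ M := by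
    rw [hM]
    have : 0 ≤ K₂ + |centeredAverage f x₀ (r₂ / (2 * √n))| + (ρ / r₂) ^ n * B := by positivity
    linarith
  have hM2 : K₂ + |centeredAverage f x₀ (r₂ / (2 * √n))| + (ρ / r₂) ^ n * B ≤ M := by
    rw [hM]
    have : 0 ≤ B + (K₁ + 2 ^ n * B) := by positivity
    linarith
  have hM0 : 0 ≤ M := by rw [hM]; positivity
  refine ⟨M, hM0, fun k => ?_⟩
  have hhalf : ∀ r : ℝ, 0 < r → ∀ x, Metric.ball x r ⊆ Ω →
      cube (corner x (r / (2 * √n))) (2 * (r / (2 * √n))) ⊆ Ω := fun r hr x hx =>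
    (cube_corner_subset_ball hn hr (by positivity) le_rfl).trans hx
  induction k with
  | zero =>
    intro x hx
    rw [pow_zero, div_one] at hx ⊢
    have hQ := hhalf ρ hρ0 x hx
    have hside : 2 * (ρ / (2 * √n)) = naturalScale n ε δ := by
      rw [hρ]; field_simp
    have h1 := abs_average_le_of_average_le (by positivity) hB
      (H _ _ (by positivity) hQ).1 (Hlarge _ _ (by positivity) hside.ge hQ)
    have h2 : 0 ≤ K₁ + 2 ^ n * B := by positivity
    refine h1.trans ?_
    push_cast
    linarith
  | succ k ih =>
    intro x hx
    obtain ⟨r, hr⟩ : ∃ r, r = ρ / 2 ^ (k + 1) := ⟨_, rfl⟩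
    have hr0 : 0 < r := by rw [hr]; positivity
    have hr2 : ρ / 2 ^ k = 2 * r := by rw [hr, pow_succ]; field_simp
    have hrρ : r ≤ ρ := by
      rw [hr]
      exact div_le_self hρ0.le (one_le_pow₀ (by norm_num))
    rw [hr2] at ih
    rw [← hr] at hx ⊢
    have hxΩ : x ∈ Ω := hx (Metric.mem_ball_self hr0)
    have h8 : 8 * r / ε ≤ 8 * ρ / ε := by gcongr
    push_cast
    by_cases hfar : ∃ y ∈ Ω, 8 * r / ε ≤ dist x y
    · obtain ⟨y, hy, hxy⟩ := hfar
      obtain ⟨z, hz, hxz⟩ := hΩ.exists_ball_two_mul_subset hr0 hxΩ (by linarith) hy hxy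
      have hzr : Metric.ball z r ⊆ Ω := (Metric.ball_subset_ball (by linarith)).trans hz
      have h48 : 8 * r / ε = 4 * r / ε + 4 * r / ε := by ring
      have h4 : 0 < 4 * r / ε := by positivity
      have h1 := hup r x z hr0 hx hzr (by rw [hxz]; apply le_of_eq; ring) (by linarith)
      have h2 := H.abs_centeredAverage_sub_le hB (x := z) (y := z) (h := r / (2 * √n))
        (k := 2 * r / (2 * √n)) (by positivity)
        (by rw [dist_self, zero_add]; gcongr; linarith) (hhalf _ (by positivity) z hz)
      have h3 := ih z hz
      have h5 : 2 * r / (2 * √n) / (r / (2 * √n)) = 2 := by field_simp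
      rw [h5] at h2
      rw [abs_le] at *
      constructor <;> nlinarith
    · push Not at hfar
      have hr₂r : r₂ ≤ r := by
        have h1 := hfar x₀ hx₀
        have h2 := hfar x₁ hx₁
        have h3 := dist_triangle_left x₀ x₁ x
        have h4 : dist x₀ x₁ ≤ 16 * r / ε := by
          have : 16 * r / ε = 8 * r / ε + 8 * r / ε := by ring
          linarith
        rw [le_div_iff₀ hε] at h4
        linarith
      have hdx := hfar x₀ hx₀
      have h1 := hconn r₂ x x₀ hr₂0 ((Metric.ball_subset_ball hr₂r).trans hx)
        ((Metric.ball_subset_ball hr₂r₀).trans hr₀Ω)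
        (by
          have : 8 * ρ / (ε * r₂) * r₂ = 8 * ρ / ε := by field_simp
          rw [this]; linarith) (by linarith)
      have h2 := H.abs_centeredAverage_sub_le hB (x := x) (y := x) (h := r₂ / (2 * √n))
        (k := r / (2 * √n)) (by positivity)
        (by rw [dist_self, zero_add]; gcongr) (hhalf _ hr0 x hx)
      have h5 : r / (2 * √n) / (r₂ / (2 * √n)) = r / r₂ := by field_simp
      have h6 : (r / r₂) ^ n * B ≤ (ρ / r₂) ^ n * B := by gcongr
      rw [h5] at h2
      have h7 : |centeredAverage f x (r / (2 * √n))| ≤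
          K₂ + |centeredAverage f x₀ (r₂ / (2 * √n))| + (ρ / r₂) ^ n * B := by
        have h8 := le_abs_self (centeredAverage f x₀ (r₂ / (2 * √n)))
        have h9 := neg_abs_le (centeredAverage f x₀ (r₂ / (2 * √n)))
        generalize |centeredAverage f x₀ (r₂ / (2 * √n))| = w at *
        rw [abs_le] at *
        constructor <;> linarith
      refine h7.trans (hM2.trans (le_mul_of_one_le_right hM0 ?_))
      have : (0 : ℝ) ≤ k := by positivity
      linarith

/-- `M` bounds the growth of the averages of `f` over the cubes in `Ω`: they are at most
`M * (1 + log⁺ (1 / l))`, where `l` is the sidelength. -/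
def HasLogGrowth (Ω : Set (EuclideanSpace ℝ (Fin n))) (f : EuclideanSpace ℝ (Fin n) → ℝ)
    (M : ℝ) : Prop :=
  ∀ (a : EuclideanSpace ℝ (Fin n)) (l : ℝ), 0 < l → cube a l ⊆ Ω →
    |⨍ x in cube a l, f x| ≤ M * (1 + Real.posLog (1 / l))

theorem MemBmo.hasMeanOscLE {lam : ℝ} (hf : MemBmo lam Ω f) :
    HasMeanOscLE Ω f (2 * (bmoNorm lam Ω f).toReal) := by
  intro a l hl hQ
  refine ⟨hf.1 a l hl hQ,
    (meanOsc_le_two_mul_bmoNorm (lam := lam) hl hQ (hf.1 a l hl hQ)).trans ?_⟩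
  rw [ENNReal.ofReal_mul (by norm_num), ENNReal.ofReal_toReal hf.2.ne]
  simp

/-- The averages of a function in `bmo(Ω)` over the cubes in `Ω` grow at most logarithmically as
the sidelength tends to zero. -/
theorem IsEpsDeltaDomain.exists_hasLogGrowth (hΩ : IsEpsDeltaDomain ε δ Ω) (hn : 1 ≤ n)
    (hf : MemBmo (naturalScale n ε δ) Ω f) : ∃ M : ℝ, 0 ≤ M ∧ HasLogGrowth Ω f M := by
  have hn' : 0 < √(n : ℝ) := Real.sqrt_pos.2 (by exact_mod_cast hn)
  have hn1 : 1 ≤ √(n : ℝ) := Real.one_le_sqrt.2 (by exact_mod_cast hn)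
  have hlam := naturalScale_pos hn hΩ.eps_pos hΩ.delta_pos
  have H := hf.hasMeanOscLE
  obtain ⟨B, hBdef⟩ : ∃ B, B = 2 * (bmoNorm (naturalScale n ε δ) Ω f).toReal := ⟨_, rfl⟩
  rw [← hBdef] at H
  have hB : 0 ≤ B := by rw [hBdef]; positivity
  have Hlarge : ∀ (a : EuclideanSpace ℝ (Fin n)) (l : ℝ), 0 < l → naturalScale n ε δ ≤ l →
      cube a l ⊆ Ω → ⨍⁻ x in cube a l, ‖f x‖ₑ ∂volume ≤ ENNReal.ofReal B := by
    intro a l h1 h2 h3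
    refine (average_le_bmoNorm h1 h2 h3).trans ?_
    rw [hBdef, ENNReal.ofReal_mul (by norm_num), ENNReal.ofReal_toReal hf.2.ne]
    simp only [ENNReal.ofReal_ofNat, two_mul]
    exact le_self_add
  obtain ⟨M, hM, hdy⟩ := hΩ.exists_abs_centeredAverage_le hn H hB Hlarge
  obtain ⟨ρ, hρ⟩ : ∃ ρ, ρ = √n * naturalScale n ε δ := ⟨_, rfl⟩
  rw [← hρ] at hdy
  have hρ0 : 0 < ρ := by rw [hρ]; positivity
  have hP := Real.posLog_nonneg (x := 4 * ρ)
  refine ⟨(4 * √n) ^ n * B + M * (3 + 2 * Real.posLog (4 * ρ)), by positivity, ?_⟩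
  intro a l hl hQ
  have hP' := Real.posLog_nonneg (x := 1 / l)
  have hn4 : 1 ≤ (4 * √(n : ℝ)) ^ n := one_le_pow₀ (by linarith)
  rcases lt_or_ge l (naturalScale n ε δ) with h | h
  · have hx0 : 0 < l / 2 / ρ := by positivity
    have hx1 : l / 2 / ρ ≤ 1 := by
      rw [div_le_one hρ0, hρ]
      nlinarith
    obtain ⟨j, hj1, hj2⟩ := exists_nat_pow_near_of_lt_one hx0 hx1 (by norm_num : (0 : ℝ) < 1 / 2)
      (by norm_num)
    obtain ⟨r, hr⟩ : ∃ r, r = ρ / 2 ^ (j + 1) := ⟨_, rfl⟩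
    have hr0 : 0 < r := by rw [hr]; positivity
    have hrl : r ≤ l / 2 := by
      rw [lt_div_iff₀ hρ0] at hj1
      rw [hr, div_eq_mul_inv, ← inv_pow]
      norm_num at hj1 ⊢
      linarith
    have hlr : l ≤ 4 * r := by
      rw [div_le_iff₀ hρ0] at hj2
      rw [hr, pow_succ, div_eq_mul_inv, mul_inv, ← inv_pow]
      norm_num at hj2 ⊢
      linarith
    have hball : Metric.ball (corner a (-(l / 2))) r ⊆ Ω :=
      (Metric.ball_subset_ball hrl).trans ((ball_center_subset_cube a l).trans hQ)
    have h1 := hdy (j + 1) _ (hr ▸ hball)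
    rw [← hr] at h1
    have h2 := H.abs_centeredAverage_sub_le hB (x := corner a (-(l / 2)))
      (y := corner a (-(l / 2))) (h := r / (2 * √n)) (k := l / 2) (by positivity)
      (by
        rw [dist_self, zero_add]
        refine (div_le_self hr0.le ?_).trans hrl
        linarith) (by rwa [← cube_eq_cube_corner])
    have h3 : centeredAverage f (corner a (-(l / 2))) (l / 2) = ⨍ x in cube a l, f x := by
      rw [centeredAverage, ← cube_eq_cube_corner]
    rw [h3] at h2
    have h4 : (l / 2 / (r / (2 * √n))) ^ n * B ≤ (4 * √n) ^ n * B := by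
      gcongr
      rw [div_div_eq_mul_div, div_le_iff₀ hr0]
      nlinarith
    have h5 : ((j + 1 : ℕ) : ℝ) ≤ 2 * (Real.posLog (4 * ρ) + Real.posLog (1 / l)) := by
      have h6 : (2 : ℝ) ^ (j + 1) ≤ 4 * ρ * (1 / l) := by
        rw [mul_one_div, le_div_iff₀ hl]
        rw [hr] at hlr
        calc (2 : ℝ) ^ (j + 1) * l ≤ 2 ^ (j + 1) * (4 * (ρ / 2 ^ (j + 1))) := by gcongr
          _ = 4 * ρ := by field_simp
      have h7 := Real.posLog_le_posLog (by positivity) h6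
      rw [Real.posLog_pow] at h7
      have h8 : (1 / 2 : ℝ) ≤ Real.posLog 2 := by
        rw [Real.posLog_eq_log (by norm_num)]
        linarith [Real.log_two_gt_d9]
      have h9 := Real.posLog_mul (x := 4 * ρ) (y := 1 / l)
      have h10 : ((j + 1 : ℕ) : ℝ) * (1 / 2) ≤ ((j + 1 : ℕ) : ℝ) * Real.posLog 2 := by gcongr
      linarith
    have h6 : |⨍ x in cube a l, f x| ≤ (4 * √n) ^ n * B + M * (1 + ((j + 1 : ℕ) : ℝ)) := by
      rw [abs_le] at *
      constructor <;> linarith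
    have h7 : M * (1 + ((j + 1 : ℕ) : ℝ)) ≤
        M * (1 + 2 * (Real.posLog (4 * ρ) + Real.posLog (1 / l))) := by gcongr
    have h8 : 0 ≤ (4 * √n) ^ n * B * Real.posLog (1 / l) := by positivity
    have h9 : 0 ≤ M * Real.posLog (4 * ρ) * Real.posLog (1 / l) := by positivity
    have h10 : 0 ≤ M * Real.posLog (1 / l) := by positivity
    nlinarith
  · refine (abs_average_le_of_average_le hl hB (hf.1 a l hl hQ) (Hlarge a l hl h hQ)).trans ?_
    have h1 : B ≤ (4 * √n) ^ n * B := le_mul_of_one_le_left hB hn4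
    have h2 : 0 ≤ M * (3 + 2 * Real.posLog (4 * ρ)) := by positivity
    refine le_trans ?_ (le_mul_of_one_le_right (by positivity) (by linarith))
    linarith

end Growth

/-! ### Products with cutoff functions -/

section Products

variable {n : ℕ} {Ω : Set (EuclideanSpace ℝ (Fin n))} {f φ : EuclideanSpace ℝ (Fin n) → ℝ}

theorem integrableOn_mul_cutoff {s : Set (EuclideanSpace ℝ (Fin n))} (hφ : Measurable φ)
    (hφ1 : ∀ x, |φ x| ≤ 1) (hf : IntegrableOn f s) : IntegrableOn (φ * f) s :=
  hf.bdd_mul hφ.aestronglyMeasurable (Eventually.of_forall hφ1)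

/-- Multiplication by a cutoff function preserves the mean oscillation over a cube up to the product
of the average of `f` and the mean deviation of the cutoff function from any of its values. -/
theorem meanOsc_mul_le (hφ : Measurable φ) (hφ1 : ∀ x, |φ x| ≤ 1)
    {a : EuclideanSpace ℝ (Fin n)} {l : ℝ} (hl : 0 < l) (hf : IntegrableOn f (cube a l))
    (x₀ : EuclideanSpace ℝ (Fin n)) :
    ⨍⁻ x in cube a l, ‖(φ * f) x - ⨍ y in cube a l, (φ * f) y‖ₑ ∂volume ≤
      2 * ((⨍⁻ x in cube a l, ‖f x - ⨍ y in cube a l, f y‖ₑ ∂volume) +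
        ‖⨍ y in cube a l, f y‖ₑ * ⨍⁻ x in cube a l, ‖φ x - φ x₀‖ₑ ∂volume) := by
  refine (meanOsc_le_two_mul (volume_cube_ne_zero a hl) (volume_cube_ne_top a l)
    (integrableOn_mul_cutoff hφ hφ1 hf) (φ x₀ * ⨍ y in cube a l, f y)).trans ?_
  gcongr
  refine (setLAverage_add_le
    (u := fun x => ‖f x - ⨍ y in cube a l, f y‖ₑ)
    (v := fun x => ‖⨍ y in cube a l, f y‖ₑ * ‖φ x - φ x₀‖ₑ)
    (hf.aestronglyMeasurable.sub aestronglyMeasurable_const).enorm fun x => ?_).trans ?_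
  · have : (φ * f) x - φ x₀ * ⨍ y in cube a l, f y =
        φ x * (f x - ⨍ y in cube a l, f y) + (⨍ y in cube a l, f y) * (φ x - φ x₀) := by
      rw [Pi.mul_apply]
      ring
    rw [this]
    refine (enorm_add_le _ _).trans ?_
    rw [enorm_mul, enorm_mul]
    gcongr
    refine mul_le_of_le_one_left' ?_
    rw [Real.enorm_eq_ofReal_abs, ENNReal.ofReal_le_one]
    exact hφ1 x
  · gcongr
    rw [setLAverage_eq, setLAverage_eq, lintegral_const_mul' _ _ enorm_ne_top, mul_div_assoc]

theorem meanOsc_eq_zero_of_eqOn_zero {a : EuclideanSpace ℝ (Fin n)} {l : ℝ}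
    (h : ∀ x ∈ cube a l, f x = 0) :
    ⨍⁻ x in cube a l, ‖f x - ⨍ y in cube a l, f y‖ₑ ∂volume = 0 := by
  have h1 : ⨍ y in cube a l, f y = 0 := by
    rw [setAverage_congr_fun (measurableSet_cube a l)
      (Eventually.of_forall fun x hx => h x hx : ∀ᵐ x, x ∈ cube a l → f x = (fun _ => 0) x)]
    simp
  rw [h1, setLAverage_congr_fun (measurableSet_cube a l) (g := fun _ => 0)]
  · simp
  · intro x hx
    simp [h x hx]

theorem enorm_mul_cutoff_le (hφ1 : ∀ x, |φ x| ≤ 1) (x : EuclideanSpace ℝ (Fin n)) :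
    ‖(φ * f) x‖ₑ ≤ ‖f x‖ₑ := by
  rw [Pi.mul_apply, enorm_mul]
  refine mul_le_of_le_one_left' ?_
  rw [Real.enorm_eq_ofReal_abs, ENNReal.ofReal_le_one]
  exact hφ1 x

theorem average_enorm_le {a : EuclideanSpace ℝ (Fin n)} {l : ℝ} (hl : 0 < l) :
    ⨍⁻ x in cube a l, ‖f x‖ₑ ∂volume ≤
      (⨍⁻ x in cube a l, ‖f x - ⨍ y in cube a l, f y‖ₑ ∂volume) + ‖⨍ y in cube a l, f y‖ₑ := by
  rw [← setLAverage_add_const (volume_cube_ne_zero a hl) (volume_cube_ne_top a l)]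
  refine laverage_mono_ae (Eventually.of_forall fun x => ?_)
  simpa using enorm_add_le (f x - ⨍ y in cube a l, f y) (⨍ y in cube a l, f y)

theorem mul_posLog_one_div_le {l : ℝ} (hl : 0 < l) : l * Real.posLog (1 / l) ≤ 1 := by
  have h1 : Real.posLog (1 / l) ≤ 1 / l := by
    rw [Real.posLog_apply]
    refine max_le (by positivity) ?_
    have := Real.log_le_sub_one_of_pos (show 0 < 1 / l by positivity)
    linarith
  calc l * Real.posLog (1 / l) ≤ l * (1 / l) := by gcongr
    _ = 1 := by field_simp

/-- The nearest point of `[0, 1]`. -/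
def unitClamp (t : ℝ) : ℝ := max (min t 1) 0

theorem abs_unitClamp_le (t : ℝ) : |unitClamp t| ≤ 1 := by
  rw [unitClamp, abs_of_nonneg (le_max_right _ _)]
  exact max_le (min_le_right _ _) zero_le_one

theorem unitClamp_of_nonpos {t : ℝ} (ht : t ≤ 0) : unitClamp t = 0 :=
  max_eq_right ((min_le_left _ _).trans ht)

theorem unitClamp_of_one_le {t : ℝ} (ht : 1 ≤ t) : unitClamp t = 1 := by
  rw [unitClamp, min_eq_right ht]
  exact max_eq_left zero_le_one

theorem abs_unitClamp_sub_le (s t : ℝ) : |unitClamp s - unitClamp t| ≤ |s - t| := by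
  refine (abs_max_sub_max_le_abs _ _ _).trans ((abs_min_sub_min_le_max _ _ _ _).trans ?_)
  simp

/-- The number `⌊l / t⌋` of pieces cuts a segment of length `l` into pieces of length in
`[t, 2 t]`. -/
theorem exists_nat_mul_eq {l t : ℝ} (ht : 0 < t) (htl : t ≤ l) :
    ∃ (m : ℕ) (τ : ℝ), 0 < m ∧ t ≤ τ ∧ τ ≤ 2 * t ∧ m * τ = l := by
  have h1 : 1 ≤ l / t := by rwa [le_div_iff₀ ht, one_mul]
  have hm : 0 < ⌊l / t⌋₊ := Nat.floor_pos.2 h1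
  have hm' : (1 : ℝ) ≤ ⌊l / t⌋₊ := by exact_mod_cast hm
  have h2 := Nat.floor_le (show 0 ≤ l / t by linarith)
  have h3 := Nat.lt_floor_add_one (l / t)
  rw [le_div_iff₀ ht] at h2
  rw [div_lt_iff₀ ht] at h3
  refine ⟨⌊l / t⌋₊, l / ⌊l / t⌋₊, hm, ?_, ?_, by field_simp⟩
  · rw [le_div_iff₀ (by linarith)]
    linarith
  · rw [div_le_iff₀ (by linarith)]
    nlinarith

end Products

/-! ### Cutoff at infinity -/

section Infinity

variable {n : ℕ} {Ω : Set (EuclideanSpace ℝ (Fin n))} {f : EuclideanSpace ℝ (Fin n) → ℝ}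

/-- The cutoff function that is `0` where `‖x‖ ≤ 2 * R`, is `1` where `‖x‖ ≥ 3 * R`, and has
Lipschitz constant `1 / R`. -/
noncomputable def infinityCutoff (n : ℕ) (R : ℝ) (x : EuclideanSpace ℝ (Fin n)) : ℝ :=
  unitClamp (‖x‖ / R - 2)

theorem measurable_infinityCutoff (R : ℝ) : Measurable (infinityCutoff n R) := by
  unfold infinityCutoff unitClamp
  fun_prop

theorem abs_infinityCutoff_le (R : ℝ) (x : EuclideanSpace ℝ (Fin n)) :
    |infinityCutoff n R x| ≤ 1 :=
  abs_unitClamp_le _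

theorem infinityCutoff_eq_zero {R : ℝ} (hR : 0 < R) {x : EuclideanSpace ℝ (Fin n)}
    (hx : ‖x‖ ≤ 2 * R) : infinityCutoff n R x = 0 := by
  refine unitClamp_of_nonpos ?_
  rw [sub_nonpos, div_le_iff₀ hR]
  exact hx

theorem infinityCutoff_eq_one {R : ℝ} (hR : 0 < R) {x : EuclideanSpace ℝ (Fin n)}
    (hx : 3 * R ≤ ‖x‖) : infinityCutoff n R x = 1 := by
  refine unitClamp_of_one_le ?_
  rw [le_sub_iff_add_le, le_div_iff₀ hR]
  linarith

theorem abs_infinityCutoff_sub_le {R : ℝ} (hR : 0 < R) (x y : EuclideanSpace ℝ (Fin n)) :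
    |infinityCutoff n R x - infinityCutoff n R y| ≤ dist x y / R := by
  refine (abs_unitClamp_sub_le _ _).trans ?_
  rw [sub_sub_sub_cancel_right, ← sub_div, abs_div, abs_of_pos hR]
  gcongr
  rw [dist_eq_norm]
  exact abs_norm_sub_norm_le x y

/-- Since `f` grows only logarithmically, the oscillation of the cutoff function on a cube with
sidelength `l`, of order `l / R`, beats the average of `f` over the cube. -/
theorem bmoNorm_infinityCutoff_mul_le {lam M R : ℝ} {κ : ℝ≥0∞} (hlam : 0 < lam)
    (hf : ∀ (a : EuclideanSpace ℝ (Fin n)) (l : ℝ), 0 < l → cube a l ⊆ Ω →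
      IntegrableOn f (cube a l))
    (hM : 0 ≤ M) (hgrowth : HasLogGrowth Ω f M) (hR : 0 < R) (hRlam : 2 * √n * lam ≤ R)
    (hκ : bmoNorm lam (Ω \ Metric.closedBall 0 R) f ≤ κ) :
    bmoNorm lam Ω (infinityCutoff n R * f) ≤
      2 * (κ + ENNReal.ofReal (M * √n * (lam + 1) / R)) + κ := by
  have hfar : ∀ (a : EuclideanSpace ℝ (Fin n)) (l : ℝ), 0 < l → l ≤ 2 * lam → cube a l ⊆ Ω →
      (∃ x ∈ cube a l, infinityCutoff n R x ≠ 0) →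
      cube a l ⊆ Ω \ Metric.closedBall 0 R := by
    rintro a l hl hl2 hQ ⟨z, hz, hz0⟩ x hx
    refine ⟨hQ hx, fun hxR => hz0 (infinityCutoff_eq_zero hR ?_)⟩
    rw [mem_closedBall_zero_iff] at hxR
    have h1 := dist_le_of_mem_cube hl.le hz hx
    have h2 : √n * l ≤ √n * (2 * lam) := by gcongr
    have h3 := norm_le_norm_add_norm_sub' z x
    rw [dist_eq_norm] at h1
    linarith
  refine bmoNorm_le (fun a l hl hlt hQ => ?_) (fun a l hl hlt hQ => ?_)
  · by_cases hz : ∃ x ∈ cube a l, infinityCutoff n R x ≠ 0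
    · have hQ' := hfar a l hl (by linarith) hQ hz
      refine (meanOsc_mul_le (measurable_infinityCutoff R) (abs_infinityCutoff_le R) hl
        (hf a l hl hQ) (corner a (-(l / 2)))).trans ?_
      gcongr
      · exact (meanOsc_le_bmoNorm hl hlt hQ').trans hκ
      · have hP := Real.posLog_nonneg (x := 1 / l)
        have h1 : ‖⨍ y in cube a l, f y‖ₑ ≤ ENNReal.ofReal (M * (1 + Real.posLog (1 / l))) := by
          rw [Real.enorm_eq_ofReal_abs]
          exact ENNReal.ofReal_le_ofReal (hgrowth a l hl hQ)
        have h2 : ⨍⁻ x in cube a l, ‖infinityCutoff n R x -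
            infinityCutoff n R (corner a (-(l / 2)))‖ₑ ∂volume ≤ ENNReal.ofReal (√n * l / R) := by
          refine setLAverage_le_of_forall_le (measurableSet_cube a l) fun x hx => ?_
          rw [Real.enorm_eq_ofReal_abs]
          refine ENNReal.ofReal_le_ofReal ((abs_infinityCutoff_sub_le hR _ _).trans ?_)
          gcongr
          exact dist_le_of_mem_cube hl.le hx (center_mem_cube a hl.le)
        refine (mul_le_mul' h1 h2).trans ?_
        rw [← ENNReal.ofReal_mul (by positivity)]
        refine ENNReal.ofReal_le_ofReal ?_
        rw [mul_div_assoc']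
        gcongr ?_ / R
        have h3 := mul_posLog_one_div_le hl
        have h4 : M * (1 + Real.posLog (1 / l)) * (√n * l) =
            M * √n * (l + l * Real.posLog (1 / l)) := by ring
        rw [h4]
        gcongr
    · push Not at hz
      rw [meanOsc_eq_zero_of_eqOn_zero fun x hx => by rw [Pi.mul_apply, hz x hx, zero_mul]]
      exact bot_le
  · obtain ⟨m, τ, hm, hτ1, hτ2, rfl⟩ := exists_nat_mul_eq hlam hlt
    have hτ0 : 0 < τ := by linarith
    classical
    refine (setLAverage_cube_le_of_cells a hτ0
      (Finset.univ.filter fun k : Fin n → Fin m =>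
        ∃ x ∈ cube (cellCorner a τ k) τ, infinityCutoff n R x ≠ 0) (K := κ) ?_ ?_).trans ?_
    · intro x hx hne
      obtain ⟨k, hk⟩ := exists_mem_cell hm hτ0 hx
      refine ⟨k, ?_, hk⟩
      rw [Finset.mem_filter]
      refine ⟨Finset.mem_univ _, x, hk, fun h0 => hne ?_⟩
      rw [Pi.mul_apply, h0, zero_mul, enorm_zero]
    · intro k hk
      have hQ' := hfar _ τ hτ0 hτ2 ((cell_subset_cube a hτ0 k).trans hQ) (Finset.mem_filter.1 hk).2
      refine le_trans (laverage_mono_ae (Eventually.of_forall fun x => ?_))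
        ((average_le_bmoNorm hτ0 hτ1 hQ').trans hκ)
      exact enorm_mul_cutoff_le (abs_infinityCutoff_le R) x
    · refine mul_le_of_le_one_left' ?_
      refine ENNReal.div_le_of_le_mul ?_
      rw [one_mul]
      calc ((Finset.univ.filter fun k : Fin n → Fin m =>
          ∃ x ∈ cube (cellCorner a τ k) τ, infinityCutoff n R x ≠ 0).card : ℝ≥0∞)
          ≤ ((Finset.univ : Finset (Fin n → Fin m)).card : ℝ≥0∞) := by
            exact_mod_cast Finset.card_filter_le _ _
        _ = (m : ℝ≥0∞) ^ n := by simp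

end Infinity

/-! ### Cutoff at the boundary -/

section Boundary

variable {n : ℕ} {Ω : Set (EuclideanSpace ℝ (Fin n))} {f : EuclideanSpace ℝ (Fin n) → ℝ}

theorem infDist_compl_pos (hΩ : IsOpen Ω) (hne : Ω ≠ univ) {x : EuclideanSpace ℝ (Fin n)}
    (hx : x ∈ Ω) : 0 < Metric.infDist x Ωᶜ :=
  (hΩ.isClosed_compl.notMem_iff_infDist_pos (nonempty_compl.2 hne)).1 (notMem_compl_iff.2 hx)

theorem le_infDist_compl (hne : Ω ≠ univ) {x : EuclideanSpace ℝ (Fin n)} {r : ℝ}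
    (h : Metric.ball x r ⊆ Ω) : r ≤ Metric.infDist x Ωᶜ := by
  rw [Metric.le_infDist (nonempty_compl.2 hne)]
  intro y hy
  by_contra! hlt
  rw [dist_comm] at hlt
  exact hy (h hlt)

/-- On a cube in `Ω`, the mean deviation of `log (dist x Ωᶜ)` from its value at the centre is
bounded, and is of order `l / D`, up to a logarithm, if the distance `D` of the centre to the
boundary is large compared with the sidelength `l`. -/
theorem one_add_posLog_mul_setLAverage_log_infDist_le (hn : 1 ≤ n) (hΩ : IsOpen Ω)
    (hne : Ω ≠ univ) {a : EuclideanSpace ℝ (Fin n)} {l : ℝ} (hl : 0 < l) (hQ : cube a l ⊆ Ω) :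
    ENNReal.ofReal (1 + Real.posLog (Metric.infDist (corner a (-(l / 2))) Ωᶜ / l)) *
      ⨍⁻ x in cube a l, ENNReal.ofReal |Real.log (Metric.infDist x Ωᶜ) -
        Real.log (Metric.infDist (corner a (-(l / 2))) Ωᶜ)| ∂volume ≤
      ENNReal.ofReal (3 * n ^ 2) := by
  have hn1 : (1 : ℝ) ≤ n := by exact_mod_cast hn
  have hs1 : 1 ≤ √(n : ℝ) := Real.one_le_sqrt.2 hn1
  have hss : √(n : ℝ) * √n = n := Real.mul_self_sqrt (by positivity)
  have hsn : √(n : ℝ) ≤ n := by nlinarith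
  obtain ⟨D, hD⟩ : ∃ D, D = Metric.infDist (corner a (-(l / 2))) Ωᶜ := ⟨_, rfl⟩
  rw [← hD]
  have hD0 : 0 < D := by
    rw [hD]
    exact infDist_compl_pos hΩ hne (hQ (center_mem_cube a hl.le))
  have hDl : l / 2 ≤ D := by
    rw [hD]
    exact le_infDist_compl hne ((ball_center_subset_cube a l).trans hQ)
  have hd0 : ∀ x ∈ cube a l, 0 < Metric.infDist x Ωᶜ := fun x hx =>
    infDist_compl_pos hΩ hne (hQ hx)
  have hdD : ∀ x ∈ cube a l, |Metric.infDist x Ωᶜ - D| ≤ √n * (l / 2) := by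
    intro x hx
    have h1 := Metric.infDist_le_infDist_add_dist (s := Ωᶜ) (x := x) (y := corner a (-(l / 2)))
    have h2 := Metric.infDist_le_infDist_add_dist (s := Ωᶜ) (x := corner a (-(l / 2))) (y := x)
    have h3 := dist_center_le hl.le hx
    rw [dist_comm] at h2
    rw [← hD] at h1 h2
    rw [abs_le]
    constructor <;> linarith
  have hlog_le : ∀ u v : ℝ, 0 < u → 0 < v → Real.log u - Real.log v ≤ (u - v) / v := by
    intro u v hu hv
    rw [← Real.log_div hu.ne' hv.ne', sub_div, div_self hv.ne']
    exact Real.log_le_sub_one_of_pos (by positivity)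
  rcases le_or_gt (√n * l) D with h | h
  · have hpt : ∀ x ∈ cube a l, ENNReal.ofReal |Real.log (Metric.infDist x Ωᶜ) - Real.log D| ≤
        ENNReal.ofReal (√n * l / D) := by
      intro x hx
      refine ENNReal.ofReal_le_ofReal ?_
      have h1 := hdD x hx
      have h2 := hd0 x hx
      generalize Metric.infDist x Ωᶜ = d at h1 h2
      rw [abs_le] at h1
      rw [abs_le]
      have h3 := hlog_le d D h2 hD0
      have h4 := hlog_le D d hD0 h2
      constructor
      · have : (D - d) / d ≤ √n * l / D := by
          rw [div_le_div_iff₀ h2 hD0]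
          have : D / 2 ≤ d := by linarith
          calc (D - d) * D ≤ (√n * (l / 2)) * D := by gcongr; linarith
            _ = √n * l * (D / 2) := by ring
            _ ≤ √n * l * d := by gcongr
        linarith
      · have : (d - D) / D ≤ √n * l / D := by
          gcongr
          nlinarith
        linarith
    refine (mul_le_mul' le_rfl (setLAverage_le_of_forall_le (measurableSet_cube a l) hpt)).trans ?_
    have hP := Real.posLog_nonneg (x := D / l)
    rw [← ENNReal.ofReal_mul (by positivity)]
    refine ENNReal.ofReal_le_ofReal ?_
    have h1 : 1 ≤ D / l := by
      rw [le_div_iff₀ hl]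
      nlinarith
    have h2 : 1 + Real.posLog (D / l) ≤ D / l := by
      rw [Real.posLog_eq_log (by rwa [abs_of_pos (by positivity)])]
      linarith [Real.log_le_sub_one_of_pos (show 0 < D / l by positivity)]
    calc (1 + Real.posLog (D / l)) * (√n * l / D) ≤ D / l * (√n * l / D) := by gcongr
      _ = √n := by field_simp
      _ ≤ 3 * n ^ 2 := by nlinarith
  · have hposD : Real.posLog (D / l) ≤ √n - 1 := by
      rw [Real.posLog_apply]
      refine max_le (by linarith) ?_
      have h1 : D / l ≤ √n := by rw [div_le_iff₀ hl]; exact h.le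
      linarith [Real.log_le_sub_one_of_pos (show 0 < D / l by positivity)]
    have hpt : ∀ x ∈ cube a l, ENNReal.ofReal |Real.log (Metric.infDist x Ωᶜ) - Real.log D| ≤
        ENNReal.ofReal (Real.posLog (l / Metric.infDist x Ωᶜ)) + ENNReal.ofReal (√n) := by
      intro x hx
      have h1 := hdD x hx
      have h2 := hd0 x hx
      generalize Metric.infDist x Ωᶜ = d at h1 h2
      have hP := Real.posLog_nonneg (x := l / d)
      rw [← ENNReal.ofReal_add hP (by positivity)]
      refine ENNReal.ofReal_le_ofReal ?_
      rw [abs_le] at h1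
      rw [abs_le]
      have h3 := hlog_le d D h2 hD0
      constructor
      · have h4 : Real.log D - Real.log d ≤ Real.posLog (D / l) + Real.posLog (l / d) := by
          rw [← Real.log_div hD0.ne' h2.ne']
          have h5 : D / d = D / l * (l / d) := by field_simp
          rw [h5]
          exact (le_max_right _ _).trans Real.posLog_mul
        linarith
      · have : (d - D) / D ≤ √n := by
          rw [div_le_iff₀ hD0]
          nlinarith
        linarith
    have havg : ⨍⁻ x in cube a l,
        ENNReal.ofReal |Real.log (Metric.infDist x Ωᶜ) - Real.log D| ∂volume ≤
        ENNReal.ofReal (2 * n + √n) := by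
      refine (setLAverage_mono_on (measurableSet_cube a l) hpt).trans ?_
      rw [setLAverage_add_const (volume_cube_ne_zero a hl) (volume_cube_ne_top a l),
        ENNReal.ofReal_add (by positivity) (by positivity)]
      gcongr
      refine setLAverage_posLog_div_le a hl
        (Metric.continuous_infDist_pt _).measurable fun x _ r _ hb => ?_
      exact le_infDist_compl hne (hb.trans hQ)
    refine (mul_le_mul' le_rfl havg).trans ?_
    rw [← ENNReal.ofReal_mul (by linarith [Real.posLog_nonneg (x := D / l)])]
    refine ENNReal.ofReal_le_ofReal ?_
    calc (1 + Real.posLog (D / l)) * (2 * n + √n) ≤ √n * (2 * n + √n) := by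
          gcongr
          linarith
      _ ≤ 3 * n ^ 2 := by nlinarith

/-- The cutoff function `s * log (log (T / d)) - K`, clamped to `[0, 1]`, where `d` is the distance
to the complement of `Ω` and the inner logarithm is replaced with `1` where it is smaller. Its
oscillation on a Whitney cube of sidelength `l` is of order `s / log (1 / l)`. -/
noncomputable def boundaryCutoff (Ω : Set (EuclideanSpace ℝ (Fin n))) (T s K : ℝ)
    (x : EuclideanSpace ℝ (Fin n)) : ℝ :=
  unitClamp (s * Real.log (max 1 (Real.log (T / Metric.infDist x Ωᶜ))) - K)

theorem measurable_boundaryCutoff (T s K : ℝ) : Measurable (boundaryCutoff Ω T s K) := by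
  have : Measurable fun x => Metric.infDist x Ωᶜ := (Metric.continuous_infDist_pt _).measurable
  unfold boundaryCutoff unitClamp
  fun_prop

theorem abs_boundaryCutoff_le (T s K : ℝ) (x : EuclideanSpace ℝ (Fin n)) :
    |boundaryCutoff Ω T s K x| ≤ 1 :=
  abs_unitClamp_le _

theorem infDist_compl_lt_of_boundaryCutoff_ne_zero (hΩ : IsOpen Ω) (hne : Ω ≠ univ) {T t s : ℝ}
    (hT : 0 < T) (ht : 0 < t) (hs : 0 < s) {x : EuclideanSpace ℝ (Fin n)} (hx : x ∈ Ω)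
    (h : boundaryCutoff Ω T s (s * Real.log (max 1 (Real.log (T / t)))) x ≠ 0) :
    Metric.infDist x Ωᶜ < t := by
  have hd := infDist_compl_pos hΩ hne hx
  by_contra! hcon
  refine h (unitClamp_of_nonpos ?_)
  rw [sub_nonpos]
  gcongr

theorem boundaryCutoff_eq_one (hΩ : IsOpen Ω) (hne : Ω ≠ univ) {T s K : ℝ} (hT : 0 < T)
    (hs : 0 < s) {x : EuclideanSpace ℝ (Fin n)} (hx : x ∈ Ω)
    (h : Metric.infDist x Ωᶜ < T * Real.exp (-Real.exp ((K + 1) / s))) :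
    boundaryCutoff Ω T s K x = 1 := by
  have hd := infDist_compl_pos hΩ hne hx
  have h1 : Real.exp ((K + 1) / s) ≤ Real.log (T / Metric.infDist x Ωᶜ) := by
    rw [Real.le_log_iff_exp_le (by positivity), le_div_iff₀ hd]
    rw [Real.exp_neg, ← div_eq_mul_inv, lt_div_iff₀ (Real.exp_pos _)] at h
    linarith
  have h2 : (K + 1) / s ≤ Real.log (max 1 (Real.log (T / Metric.infDist x Ωᶜ))) := by
    rw [Real.le_log_iff_exp_le (lt_of_lt_of_le one_pos (le_max_left _ _))]
    exact h1.trans (le_max_right _ _)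
  rw [div_le_iff₀ hs] at h2
  exact unitClamp_of_one_le (by linarith)

theorem abs_log_sub_log_le {p q Λ : ℝ} (hp : 1 ≤ p) (hq : 1 ≤ q) (hΛ : 0 ≤ Λ) (h : q - p ≤ Λ) :
    |Real.log p - Real.log q| ≤ (1 + Λ) * |p - q| / q := by
  have hp0 : 0 < p := by linarith
  have hq0 : 0 < q := by linarith
  have hlog_le : ∀ u v : ℝ, 0 < u → 0 < v → Real.log u - Real.log v ≤ (u - v) / v := by
    intro u v hu hv
    rw [← Real.log_div hu.ne' hv.ne', sub_div, div_self hv.ne']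
    exact Real.log_le_sub_one_of_pos (by positivity)
  rcases le_total q p with hqp | hpq
  · rw [abs_of_nonneg (sub_nonneg.2 (Real.log_le_log hq0 hqp)), abs_of_nonneg (sub_nonneg.2 hqp)]
    refine (hlog_le p q hp0 hq0).trans ?_
    gcongr
    nlinarith
  · rw [abs_sub_comm, abs_sub_comm p, abs_of_nonneg (sub_nonneg.2 (Real.log_le_log hp0 hpq)),
      abs_of_nonneg (sub_nonneg.2 hpq)]
    refine (hlog_le q p hq0 hp0).trans ?_
    rw [div_le_div_iff₀ hp0 hq0]
    have h1 : q ≤ (1 + Λ) * p := by nlinarith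
    have h2 : 0 ≤ q - p := by linarith
    nlinarith

/-- The mean deviation of the boundary cutoff function on a cube, times a logarithmic bound for the
averages of `f`, is of order `s`: the double logarithm in the cutoff function compensates for the
growth of `f` at the boundary. -/
theorem enorm_average_mul_boundaryCutoff_sub_le (hn : 1 ≤ n) (hΩ : IsOpen Ω) (hne : Ω ≠ univ)
    {M T s K : ℝ} (hM : 0 ≤ M) (hgrowth : HasLogGrowth Ω f M) (hT : 0 < T) (hs : 0 < s)
    {a : EuclideanSpace ℝ (Fin n)} {l : ℝ} (hl : 0 < l) (hQ : cube a l ⊆ Ω) :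
    ‖⨍ y in cube a l, f y‖ₑ * ⨍⁻ x in cube a l, ‖boundaryCutoff Ω T s K x -
        boundaryCutoff Ω T s K (corner a (-(l / 2)))‖ₑ ∂volume ≤
      ENNReal.ofReal (s * (M * (2 + Real.posLog (1 / T)) * (1 + √n) * (3 * n ^ 2))) := by
  have hkey := one_add_posLog_mul_setLAverage_log_infDist_le hn hΩ hne hl hQ
  have hx₀ : corner a (-(l / 2)) ∈ cube a l := center_mem_cube a hl.le
  have hdist : ∀ x ∈ cube a l, dist x (corner a (-(l / 2))) ≤ √n * (l / 2) :=
    fun x hx => dist_center_le hl.le hx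
  have hDl : l / 2 ≤ Metric.infDist (corner a (-(l / 2))) Ωᶜ :=
    le_infDist_compl hne ((ball_center_subset_cube a l).trans hQ)
  generalize corner a (-(l / 2)) = x₀ at *
  have hD0 : 0 < Metric.infDist x₀ Ωᶜ := infDist_compl_pos hΩ hne (hQ hx₀)
  obtain ⟨u, hu⟩ : ∃ u : EuclideanSpace ℝ (Fin n) → ℝ,
      u = fun x => max 1 (Real.log (T / Metric.infDist x Ωᶜ)) := ⟨_, rfl⟩
  have hu1 : ∀ x, 1 ≤ u x := fun x => by rw [hu]; exact le_max_left _ _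
  have hu0 : 0 < u x₀ := lt_of_lt_of_le one_pos (hu1 _)
  have hupos : ∀ x ∈ cube a l, u x = max 1 (Real.log T - Real.log (Metric.infDist x Ωᶜ)) := by
    intro x hx
    rw [hu]
    simp only
    rw [Real.log_div hT.ne' (infDist_compl_pos hΩ hne (hQ hx)).ne']
  have hpt : ∀ x ∈ cube a l, ‖boundaryCutoff Ω T s K x - boundaryCutoff Ω T s K x₀‖ₑ ≤
      ENNReal.ofReal (s * (1 + √n) / u x₀) *
        ENNReal.ofReal |Real.log (Metric.infDist x Ωᶜ) - Real.log (Metric.infDist x₀ Ωᶜ)| := by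
    intro x hx
    have hd := infDist_compl_pos hΩ hne (hQ hx)
    have huu : |u x - u x₀| ≤
        |Real.log (Metric.infDist x Ωᶜ) - Real.log (Metric.infDist x₀ Ωᶜ)| := by
      rw [hupos x hx, hupos x₀ hx₀]
      refine (abs_max_sub_max_le_max _ _ _ _).trans ?_
      rw [sub_self, abs_zero, max_eq_right (abs_nonneg _), sub_sub_sub_cancel_left, abs_sub_comm]
    have hup : u x₀ - u x ≤ √n := by
      have h1 := Metric.infDist_le_infDist_add_dist (s := Ωᶜ) (x := x) (y := x₀)
      have h2 := hdist x hx
      have h3 : Real.log (Metric.infDist x Ωᶜ) - Real.log (Metric.infDist x₀ Ωᶜ) ≤ √n := by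
        rw [← Real.log_div hd.ne' hD0.ne']
        refine (Real.log_le_sub_one_of_pos (by positivity)).trans ?_
        rw [sub_le_iff_le_add, div_le_iff₀ hD0]
        have : √n * (l / 2) ≤ √n * Metric.infDist x₀ Ωᶜ := by gcongr
        linarith
      have h4 : u x₀ ≤ u x + √n := by
        rw [hupos x₀ hx₀]
        refine max_le ?_ ?_
        · linarith [hu1 x, Real.sqrt_nonneg (n : ℝ)]
        · have : Real.log T - Real.log (Metric.infDist x Ωᶜ) ≤ u x := by
            rw [hupos x hx]
            exact le_max_right _ _
          linarith
      linarith
    rw [← ENNReal.ofReal_mul (by positivity), Real.enorm_eq_ofReal_abs]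
    refine ENNReal.ofReal_le_ofReal ((abs_unitClamp_sub_le _ _).trans ?_)
    rw [sub_sub_sub_cancel_right, ← mul_sub, abs_mul, abs_of_pos hs]
    have h1 := abs_log_sub_log_le (hu1 x) (hu1 x₀) (Real.sqrt_nonneg _) hup
    rw [hu] at h1
    simp only at h1
    rw [hu] at huu ⊢
    simp only at huu ⊢
    have h2 := h1.trans (div_le_div_of_nonneg_right
      (mul_le_mul_of_nonneg_left huu (by positivity : 0 ≤ 1 + √(n : ℝ))) (by positivity))
    refine (mul_le_mul_of_nonneg_left h2 hs.le).trans (le_of_eq ?_)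
    ring
  have hP := Real.posLog_nonneg (x := Metric.infDist x₀ Ωᶜ / l)
  have hPT := Real.posLog_nonneg (x := 1 / T)
  have hPl := Real.posLog_nonneg (x := 1 / l)
  have hf1 : ‖⨍ y in cube a l, f y‖ₑ ≤
      ENNReal.ofReal (M * (u x₀ * (2 + Real.posLog (1 / T)))) *
        ENNReal.ofReal (1 + Real.posLog (Metric.infDist x₀ Ωᶜ / l)) := by
    rw [← ENNReal.ofReal_mul (by positivity), Real.enorm_eq_ofReal_abs]
    refine ENNReal.ofReal_le_ofReal ((hgrowth a l hl hQ).trans ?_)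
    rw [mul_assoc]
    gcongr M * ?_
    have h1 : 1 / l = 1 / T * (T / Metric.infDist x₀ Ωᶜ * (Metric.infDist x₀ Ωᶜ / l)) := by
      field_simp
    have h2 : Real.posLog (1 / l) ≤ Real.posLog (1 / T) +
        (Real.posLog (T / Metric.infDist x₀ Ωᶜ) + Real.posLog (Metric.infDist x₀ Ωᶜ / l)) := by
      rw [h1]
      refine Real.posLog_mul.trans ?_
      gcongr
      exact Real.posLog_mul
    have h3 : Real.posLog (T / Metric.infDist x₀ Ωᶜ) ≤ u x₀ := by
      rw [hu, Real.posLog_apply]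
      exact max_le_max zero_le_one le_rfl
    have h4 := hu1 x₀
    nlinarith [mul_nonneg hPT hP, mul_nonneg (sub_nonneg.2 h4) hP,
      mul_nonneg (sub_nonneg.2 h4) hPT, mul_nonneg (mul_nonneg hu0.le hPT) hP]
  have havg : ⨍⁻ x in cube a l, ‖boundaryCutoff Ω T s K x -
        boundaryCutoff Ω T s K x₀‖ₑ ∂volume ≤ ENNReal.ofReal (s * (1 + √n) / u x₀) *
      ⨍⁻ x in cube a l, ENNReal.ofReal |Real.log (Metric.infDist x Ωᶜ) -
        Real.log (Metric.infDist x₀ Ωᶜ)| ∂volume := by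
    refine (setLAverage_mono_on (measurableSet_cube a l) hpt).trans (le_of_eq ?_)
    rw [setLAverage_eq, setLAverage_eq, lintegral_const_mul' _ _ ENNReal.ofReal_ne_top,
      mul_div_assoc]
  calc _ ≤ _ := mul_le_mul' hf1 havg
    _ = ENNReal.ofReal (M * (u x₀ * (2 + Real.posLog (1 / T)))) *
        ENNReal.ofReal (s * (1 + √n) / u x₀) *
        (ENNReal.ofReal (1 + Real.posLog (Metric.infDist x₀ Ωᶜ / l)) *
          ⨍⁻ x in cube a l, ENNReal.ofReal |Real.log (Metric.infDist x Ωᶜ) -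
            Real.log (Metric.infDist x₀ Ωᶜ)| ∂volume) := by ring
    _ ≤ ENNReal.ofReal (M * (u x₀ * (2 + Real.posLog (1 / T)))) *
        ENNReal.ofReal (s * (1 + √n) / u x₀) * ENNReal.ofReal (3 * n ^ 2) := by gcongr
    _ = _ := by
        rw [← ENNReal.ofReal_mul (by positivity), ← ENNReal.ofReal_mul (by positivity)]
        congr 1
        field_simp

/-- On cubes in `Ω` with sidelength bounded below, the average of `|f|` is small if `f` is
replaced with `0` away from a thin layer at the boundary. Within such a cube the layer is covered by
few small cubes, on which the average of `|f|` grows only logarithmically. -/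
theorem exists_forall_average_mul_le (hne : Ω ≠ univ) {B M l₀ η : ℝ} (hB : 0 ≤ B)
    (H : HasMeanOscLE Ω f B) (hM : 0 ≤ M) (hgrowth : HasLogGrowth Ω f M) (hl₀ : 0 < l₀)
    (hη : 0 < η) :
    ∃ t : ℝ, 0 < t ∧ ∀ φ : EuclideanSpace ℝ (Fin n) → ℝ, (∀ x, |φ x| ≤ 1) →
      (∀ x ∈ Ω, φ x ≠ 0 → Metric.infDist x Ωᶜ < t) →
      ∀ (a : EuclideanSpace ℝ (Fin n)) (l : ℝ), l₀ ≤ l → cube a l ⊆ Ω →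
        ⨍⁻ x in cube a l, ‖(φ * f) x‖ₑ ∂volume ≤ ENNReal.ofReal η := by
  obtain ⟨C, hC⟩ : ∃ C, C = 4 * n / l₀ * (B + 3 * M) := ⟨_, rfl⟩
  have hC0 : 0 ≤ C := by rw [hC]; positivity
  obtain ⟨w, hw⟩ : ∃ w, w = min 1 (min l₀ (η / (C + 1))) := ⟨_, rfl⟩
  have hw0 : 0 < w := by rw [hw]; positivity
  have hw1 : w ≤ 1 := by rw [hw]; exact min_le_left _ _
  have hwl : w ≤ l₀ := by rw [hw]; exact (min_le_right _ _).trans (min_le_left _ _)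
  have hwη : w ≤ η / (C + 1) := by rw [hw]; exact (min_le_right _ _).trans (min_le_right _ _)
  have hww : w * w ≤ w := by nlinarith
  refine ⟨w * w, by positivity, fun φ hφ1 hφ a l hl hQ => ?_⟩
  obtain ⟨m, τ, hm, hτ1, hτ2, rfl⟩ := exists_nat_mul_eq (show 0 < w * w by positivity)
    (show w * w ≤ l by linarith)
  have hτ0 : 0 < τ := lt_of_lt_of_le (by positivity) hτ1
  have hm0 : (0 : ℝ) < m := by exact_mod_cast hm
  -- `log⁺ (1 / t) ≤ 2 / √t` with `t = w ^ 2`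
  have hlog : Real.posLog (1 / τ) ≤ 2 * (1 / w) := by
    have h1 : Real.posLog (1 / τ) ≤ Real.posLog ((1 / w) ^ 2) := by
      refine Real.posLog_le_posLog (by positivity) ?_
      rw [div_pow, one_pow, sq]
      gcongr
    rw [Real.posLog_pow] at h1
    have h2 : Real.posLog (1 / w) ≤ 1 / w := by
      rw [Real.posLog_apply]
      refine max_le (by positivity) ?_
      have := Real.log_le_sub_one_of_pos (show 0 < 1 / w by positivity)
      linarith
    push_cast at h1
    linarith
  have hP := Real.posLog_nonneg (x := 1 / τ)
  refine (setLAverage_cube_le_of_cells a hτ0 _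
    (K := ENNReal.ofReal (B + M * (1 + Real.posLog (1 / τ)))) (fun x hx hx0 =>
      exists_mem_boundary_cell hm hτ0 hx fun hb => ?_) fun k hk => ?_).trans ?_
  · have h1 : φ x ≠ 0 := fun h0 => hx0 (by rw [Pi.mul_apply, h0, zero_mul, enorm_zero])
    have h2 := hφ x (hQ hx) h1
    have h3 := le_infDist_compl hne (hb.trans hQ)
    linarith
  · have hQ' := (cell_subset_cube a hτ0 k).trans hQ
    have h1 := H _ τ hτ0 hQ'
    refine le_trans (laverage_mono_ae (Eventually.of_forall fun x => enorm_mul_cutoff_le hφ1 x))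
      ((average_enorm_le hτ0).trans ?_)
    rw [ENNReal.ofReal_add hB (by positivity)]
    refine add_le_add h1.2 ?_
    rw [Real.enorm_eq_ofReal_abs]
    exact ENNReal.ofReal_le_ofReal (hgrowth _ τ hτ0 hQ')
  · have hcard := card_boundary_cells_le (n := n) m
    have hfrac : ((Finset.univ.filter fun k : Fin n → Fin m =>
        ∃ i, (k i : ℕ) = 0 ∨ (k i : ℕ) + 1 = m).card : ℝ≥0∞) / (m : ℝ≥0∞) ^ n ≤
        ENNReal.ofReal (2 * n / m) := by
      have h1 : ((Finset.univ.filter fun k : Fin n → Fin m =>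
          ∃ i, (k i : ℕ) = 0 ∨ (k i : ℕ) + 1 = m).card : ℝ≥0∞) =
          ENNReal.ofReal (Finset.univ.filter fun k : Fin n → Fin m =>
          ∃ i, (k i : ℕ) = 0 ∨ (k i : ℕ) + 1 = m).card := by simp
      have h2 : (m : ℝ≥0∞) ^ n = ENNReal.ofReal ((m : ℝ) ^ n) := by
        rw [ENNReal.ofReal_pow hm0.le, ENNReal.ofReal_natCast]
      rw [h1, h2, ← ENNReal.ofReal_div_of_pos (by positivity)]
      refine ENNReal.ofReal_le_ofReal ?_
      rw [div_le_div_iff₀ (by positivity) hm0]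
      rcases Nat.eq_zero_or_pos n with hn | hn
      · subst hn
        simp at hcard ⊢
      · calc _ ≤ ((2 * n * m ^ (n - 1) : ℕ) : ℝ) * m := by
              gcongr
          _ = 2 * n * (m : ℝ) ^ n := by
              obtain ⟨p, rfl⟩ : ∃ p, n = p + 1 := ⟨n - 1, by omega⟩
              push_cast [Nat.add_sub_cancel]
              ring
    refine (mul_le_mul' hfrac le_rfl).trans ?_
    rw [← ENNReal.ofReal_mul (by positivity)]
    refine ENNReal.ofReal_le_ofReal ?_
    have h1 : 2 * n / (m : ℝ) ≤ 4 * n / l₀ * (w * w) := by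
      rw [div_mul_eq_mul_div, div_le_div_iff₀ hm0 hl₀]
      have : l₀ ≤ m * (2 * (w * w)) := hl.trans (by gcongr)
      calc 2 * (n : ℝ) * l₀ ≤ 2 * n * (m * (2 * (w * w))) := by gcongr
        _ = 4 * n * (w * w) * m := by ring
    have h2 : w * (B + M * (1 + Real.posLog (1 / τ))) ≤ B + 3 * M := by
      calc w * (B + M * (1 + Real.posLog (1 / τ))) ≤ w * (B + M * (1 + 2 * (1 / w))) := by gcongr
        _ = w * B + w * M + 2 * M := by field_simp; ring
        _ ≤ 1 * B + 1 * M + 2 * M := by gcongr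
        _ = _ := by ring
    calc 2 * n / (m : ℝ) * (B + M * (1 + Real.posLog (1 / τ)))
        ≤ 4 * n / l₀ * (w * w) * (B + M * (1 + Real.posLog (1 / τ))) := by gcongr
      _ = 4 * n / l₀ * (w * (B + M * (1 + Real.posLog (1 / τ)))) * w := by ring
      _ ≤ 4 * n / l₀ * (B + 3 * M) * (η / (C + 1)) := by gcongr
      _ = C * (η / (C + 1)) := by rw [hC]
      _ ≤ η := by
          rw [mul_div_assoc', div_le_iff₀ (by positivity)]
          nlinarith

/-- If `f` has small norm in the layer where the distance to the boundary is less than `T`, then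
some multiple of `f` by a cutoff function has small norm on `Ω` and agrees with `f` in a thinner
layer. -/
theorem exists_boundary_cutoff (hn : 1 ≤ n) (hΩ : IsOpen Ω) (hne : Ω ≠ univ)
    {lam B M T η : ℝ} (hlam : 0 < lam) (hB : 0 ≤ B) (H : HasMeanOscLE Ω f B) (hM : 0 ≤ M)
    (hgrowth : HasLogGrowth Ω f M) (hT : 0 < T) (hη : 0 < η)
    (hsmall : bmoNorm lam (Ω \ innerSet Ω T) f ≤ ENNReal.ofReal η) :
    ∃ φ : EuclideanSpace ℝ (Fin n) → ℝ, Measurable φ ∧ (∀ x, |φ x| ≤ 1) ∧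
      (∃ t : ℝ, 0 < t ∧ ∀ x ∈ Ω, Metric.infDist x Ωᶜ < t → φ x = 1) ∧
      bmoNorm lam Ω (φ * f) ≤ ENNReal.ofReal (5 * η) := by
  have hn1 : 1 ≤ √(n : ℝ) := Real.one_le_sqrt.2 (by exact_mod_cast hn)
  -- a cube that meets both `{d < T / 2}` and `{d ≥ T}` has sidelength at least `l₀`
  obtain ⟨l₀, hl₀⟩ : ∃ l₀, l₀ = min lam (T / (2 * √n)) := ⟨_, rfl⟩
  have hl₀0 : 0 < l₀ := by rw [hl₀]; positivity
  obtain ⟨t, ht, hstrip⟩ := exists_forall_average_mul_le hne hB H hM hgrowth hl₀0 hη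
  obtain ⟨P, hP⟩ : ∃ P, P = M * (2 + Real.posLog (1 / T)) * (1 + √n) * (3 * n ^ 2) := ⟨_, rfl⟩
  have hPT := Real.posLog_nonneg (x := 1 / T)
  have hP0 : 0 ≤ P := by rw [hP]; positivity
  obtain ⟨s, hs⟩ : ∃ s, s = η / (P + 1) := ⟨_, rfl⟩
  have hs0 : 0 < s := by rw [hs]; positivity
  have hsP : s * P ≤ η := by
    rw [hs, div_mul_eq_mul_div, div_le_iff₀ (by positivity)]
    nlinarith
  have ht' : 0 < min t (T / 2) := by positivity
  obtain ⟨K, hK⟩ : ∃ K, K = s * Real.log (max 1 (Real.log (T / min t (T / 2)))) := ⟨_, rfl⟩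
  have hsupp : ∀ x ∈ Ω, boundaryCutoff Ω T s K x ≠ 0 → Metric.infDist x Ωᶜ < min t (T / 2) := by
    intro x hx h
    rw [hK] at h
    exact infDist_compl_lt_of_boundaryCutoff_ne_zero hΩ hne hT ht' hs0 hx h
  have hφm := measurable_boundaryCutoff (Ω := Ω) T s K
  have hφ1 := abs_boundaryCutoff_le (Ω := Ω) T s K
  have hlarge := hstrip _ hφ1 fun x hx h => (hsupp x hx h).trans_le (min_le_left _ _)
  refine ⟨_, hφm, hφ1, ⟨T * Real.exp (-Real.exp ((K + 1) / s)), by positivity, fun x hx h =>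
    boundaryCutoff_eq_one hΩ hne hT hs0 hx h⟩, ?_⟩
  have h5 : ENNReal.ofReal (5 * η) =
      2 * (ENNReal.ofReal η + ENNReal.ofReal η) + ENNReal.ofReal η := by
    rw [ENNReal.ofReal_mul (by norm_num), ENNReal.ofReal_ofNat]
    ring
  rw [h5]
  refine bmoNorm_le (fun a l hl hlt hQ => ?_) fun a l hl hlt hQ =>
    hlarge a l (le_trans (by rw [hl₀]; exact min_le_left _ _) hlt) hQ
  have hfQ := (H a l hl hQ).1
  by_cases hzero : ∀ x ∈ cube a l, boundaryCutoff Ω T s K x = 0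
  · rw [meanOsc_eq_zero_of_eqOn_zero fun x hx => by rw [Pi.mul_apply, hzero x hx, zero_mul]]
    exact bot_le
  push Not at hzero
  obtain ⟨z, hz, hz0⟩ := hzero
  by_cases hin : ∀ x ∈ cube a l, Metric.infDist x Ωᶜ < T
  · have hQ' : cube a l ⊆ Ω \ innerSet Ω T := by
      refine fun x hx => ⟨hQ hx, fun hx' => ?_⟩
      have h1 := le_infDist_compl hne (ball_subset_of_le_infEDist_frontier hx'.1 hx'.2)
      exact absurd (hin x hx) (not_lt.2 h1)
    refine (meanOsc_mul_le hφm hφ1 hl hfQ (corner a (-(l / 2)))).trans ?_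
    gcongr
    · exact (meanOsc_le_bmoNorm hl hlt hQ').trans hsmall
    · refine (enorm_average_mul_boundaryCutoff_sub_le hn hΩ hne hM hgrowth hT hs0 hl hQ).trans ?_
      rw [← hP]
      exact ENNReal.ofReal_le_ofReal hsP
  · push Not at hin
    obtain ⟨w, hw, hwT⟩ := hin
    have hl₀l : l₀ ≤ l := by
      rw [hl₀]
      refine (min_le_right _ _).trans ?_
      rw [div_le_iff₀ (by positivity)]
      have h1 := (hsupp z (hQ hz) hz0).trans_le (min_le_right _ _)
      have h2 := Metric.infDist_le_infDist_add_dist (s := Ωᶜ) (x := w) (y := z)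
      have h3 := dist_le_of_mem_cube hl.le hw hz
      linarith
    refine (meanOsc_le_two_mul (volume_cube_ne_zero a hl) (volume_cube_ne_top a l)
      (integrableOn_mul_cutoff hφm hφ1 hfQ) 0).trans ?_
    simp only [sub_zero]
    gcongr
    exact (hlarge a l hl₀l hQ).trans le_self_add

end Boundary

/-! ### Supports -/

section Supports

variable {n : ℕ} {Ω U : Set (EuclideanSpace ℝ (Fin n))} {f g : EuclideanSpace ℝ (Fin n) → ℝ}

theorem volume_inter_support_eq_zero (hU : U ⊆ Ω) (h : Disjoint U (suppIn Ω f)) :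
    volume (U ∩ Function.support f) = 0 := by
  refine measure_null_of_locally_null _ fun x hx => ?_
  have hx' := disjoint_left.1 h hx.1
  simp only [suppIn, mem_ofPred_eq, not_forall, not_lt, nonpos_iff_eq_zero] at hx'
  obtain ⟨V, hV, hV0⟩ := hx'
  refine ⟨(U ∩ Function.support f) ∩ V, inter_mem_nhdsWithin _ hV, ?_⟩
  rw [inter_comm]
  exact measure_mono_null (inter_subset_inter_right _ (inter_subset_inter_left _ hU)) hV0

theorem notMem_suppIn {x : EuclideanSpace ℝ (Fin n)} (hU : U ∈ 𝓝 x)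
    (h : ∀ y ∈ U, y ∈ Ω → f y = 0) : x ∉ suppIn Ω f := by
  intro hx
  have h1 := hx U hU
  have h2 : U ∩ (Ω ∩ Function.support f) = ∅ :=
    eq_empty_of_forall_notMem fun y hy => hy.2.2 (h y hy.1 hy.2.1)
  simp [h2] at h1

theorem suppIn_mono (h : Function.support f ⊆ Function.support g) :
    suppIn Ω f ⊆ suppIn Ω g := fun _ hx V hV =>
  (hx V hV).trans_le (measure_mono (inter_subset_inter_right _ (inter_subset_inter_right _ h)))

theorem isClosed_suppIn : IsClosed (suppIn Ω f) := by
  rw [← isOpen_compl_iff, isOpen_iff_mem_nhds]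
  intro x hx
  simp only [suppIn, mem_compl_iff, mem_ofPred_eq, not_forall] at hx
  obtain ⟨V, hV, hV0⟩ := hx
  filter_upwards [eventually_mem_nhds_iff.2 hV] with y hy hy'
  exact hV0 (hy' V hy)

theorem suppIn_subset_closure : suppIn Ω f ⊆ closure Ω := by
  intro x hx
  by_contra hcl
  exact notMem_suppIn (isClosed_closure.isOpen_compl.mem_nhds hcl)
    (fun y hy hyΩ => absurd (subset_closure hyΩ) hy) hx

theorem suppIn_subset_of_setDist_pos (hΩ : IsOpen Ω)
    (h : 0 < setDist (suppIn Ω f) (frontier Ω)) : suppIn Ω f ⊆ Ω := by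
  intro x hx
  by_contra hxΩ
  have hxf : x ∈ frontier Ω := ⟨suppIn_subset_closure hx, by rwa [hΩ.interior_eq]⟩
  have h1 : setDist (suppIn Ω f) (frontier Ω) ≤ Metric.infEDist x (frontier Ω) :=
    iInf₂_le x hx
  rw [Metric.infEDist_zero_of_mem hxf] at h1
  exact absurd h (not_lt.2 h1)

theorem setDist_pos_of_isCompact {K F : Set (EuclideanSpace ℝ (Fin n))} (hK : IsCompact K)
    (hF : IsClosed F) (hKF : Disjoint K F) : 0 < setDist K F := by
  rcases K.eq_empty_or_nonempty with rfl | hne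
  · simp [setDist]
  · obtain ⟨x, hx, hmin⟩ := hK.exists_isMinOn hne (Metric.continuous_infEDist (s := F)).continuousOn
    have h1 : 0 < Metric.infEDist x F := by
      rw [Metric.infEDist_pos_iff_notMem_closure, hF.closure_eq]
      exact disjoint_left.1 hKF hx
    exact h1.trans_le (le_iInf₂ fun y hy => hmin hy)

end Supports

/-! ### Approximation -/

section Approximation

variable {n : ℕ} {lam : ℝ} {Ω : Set (EuclideanSpace ℝ (Fin n))}
  {f g : EuclideanSpace ℝ (Fin n) → ℝ}

theorem MemBmo.sub (hf : MemBmo lam Ω f) (hg : MemBmo lam Ω g) : MemBmo lam Ω (f - g) :=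
  ⟨fun a l hl hQ => (hf.1 a l hl hQ).sub (hg.1 a l hl hQ),
    (bmoNorm_sub_le hf.1 hg.1).trans_lt (ENNReal.add_lt_top.2 ⟨hf.2, hg.2⟩)⟩

theorem MemBmo.neg (hf : MemBmo lam Ω f) : MemBmo lam Ω (-f) :=
  ⟨fun a l hl hQ => (hf.1 a l hl hQ).neg, by rw [bmoNorm_neg]; exact hf.2⟩

theorem MemBmo.bmoNorm_le_add {U : Set (EuclideanSpace ℝ (Fin n))} (hf : MemBmo lam Ω f)
    (hg : MemBmo lam Ω g) (hU : U ⊆ Ω) :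
    bmoNorm lam U f ≤ bmoNorm lam Ω (f - g) + bmoNorm lam U g := by
  have h1 : f = (f - g) - (-g) := by simp
  conv_lhs => rw [h1]
  refine (bmoNorm_sub_le (fun a l hl hQ => (hf.sub hg).1 a l hl (hQ.trans hU))
    (fun a l hl hQ => hg.neg.1 a l hl (hQ.trans hU))).trans ?_
  rw [bmoNorm_neg]
  gcongr
  exact bmoNorm_mono hU

theorem MemBmo.bmoNorm_le_of_disjoint_suppIn {U : Set (EuclideanSpace ℝ (Fin n))}
    (hf : MemBmo lam Ω f) (hg : MemBmo lam Ω g) (hU : U ⊆ Ω) (h : Disjoint U (suppIn Ω g)) :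
    bmoNorm lam U f ≤ bmoNorm lam Ω (f - g) := by
  refine (hf.bmoNorm_le_add hg hU).trans ?_
  rw [bmoNorm_eq_zero_of_null (volume_inter_support_eq_zero hU h), add_zero]

theorem MemBmo.vanishesAtBoundary_of_approx (hf : MemBmo lam Ω f)
    (h : ∀ η : ℝ≥0∞, 0 < η → ∃ g, MemBmo lam Ω g ∧ 0 < setDist (suppIn Ω g) (frontier Ω) ∧
      bmoNorm lam Ω (f - g) ≤ η) : VanishesAtBoundary lam Ω f := by
  refine ENNReal.tendsto_nhds_zero.2 fun η hη => ?_
  obtain ⟨g, hg, hsupp, hfg⟩ := h η hη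
  obtain ⟨t, ht0, ht⟩ : ∃ t : ℝ, 0 < t ∧ ENNReal.ofReal t < setDist (suppIn Ω g) (frontier Ω) := by
    obtain ⟨t, -, h1, h2⟩ := ENNReal.lt_iff_exists_real_btwn.1 hsupp
    exact ⟨t, ENNReal.ofReal_pos.1 h1, h2⟩
  filter_upwards [Ioo_mem_nhdsGT ht0] with s hs
  refine (hf.bmoNorm_le_of_disjoint_suppIn hg sdiff_subset ?_).trans hfg
  rw [disjoint_left]
  intro x hx hxg
  refine hx.2 ⟨hx.1, ?_⟩
  calc ENNReal.ofReal s ≤ ENNReal.ofReal t := ENNReal.ofReal_le_ofReal hs.2.le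
    _ ≤ setDist (suppIn Ω g) (frontier Ω) := ht.le
    _ ≤ _ := iInf₂_le x hxg

theorem MemBmo.vanishesAtInfinity_of_approx (hf : MemBmo lam Ω f)
    (h : ∀ η : ℝ≥0∞, 0 < η → ∃ g, MemBmo lam Ω g ∧ IsCompact (suppIn Ω g) ∧
      bmoNorm lam Ω (f - g) ≤ η) : VanishesAtInfinity lam Ω f := by
  refine ENNReal.tendsto_nhds_zero.2 fun η hη => ?_
  obtain ⟨g, hg, hsupp, hfg⟩ := h η hη
  obtain ⟨R₀, hR₀⟩ := hsupp.isBounded.subset_closedBall 0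
  filter_upwards [eventually_ge_atTop R₀] with R hR
  refine (hf.bmoNorm_le_of_disjoint_suppIn hg sdiff_subset ?_).trans hfg
  rw [disjoint_left]
  exact fun x hx hxg => hx.2 (Metric.closedBall_subset_closedBall hR (hR₀ hxg))

/-- The approximating function is `f - φ * f` with the cutoff function `φ` at the boundary. If
`Ω` is the whole space, it is `f`, because the distance to the empty boundary is infinite. -/
theorem IsEpsDeltaDomain.exists_setDist_pos_approx {ε δ : ℝ} (hΩ : IsEpsDeltaDomain ε δ Ω)
    (hn : 1 ≤ n) (hf : MemBmo (naturalScale n ε δ) Ω f)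
    (hv : VanishesAtBoundary (naturalScale n ε δ) Ω f) {η : ℝ} (hη : 0 < η) :
    ∃ g, MemBmo (naturalScale n ε δ) Ω g ∧ 0 < setDist (suppIn Ω g) (frontier Ω) ∧
      bmoNorm (naturalScale n ε δ) Ω (f - g) ≤ ENNReal.ofReal η := by
  rcases eq_or_ne Ω univ with rfl | hne
  · refine ⟨f, hf, by simp [setDist], ?_⟩
    rw [sub_self, bmoNorm_eq_zero_of_null (by simp)]
    exact bot_le
  have hlam := naturalScale_pos hn hΩ.eps_pos hΩ.delta_pos
  obtain ⟨M, hM, hgrowth⟩ := hΩ.exists_hasLogGrowth hn hf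
  obtain ⟨T, hsmall, hT⟩ : ∃ T : ℝ,
      bmoNorm (naturalScale n ε δ) (Ω \ innerSet Ω T) f ≤ ENNReal.ofReal (η / 5) ∧ 0 < T :=
    ((ENNReal.tendsto_nhds_zero.1 hv (ENNReal.ofReal (η / 5)) (by positivity)).and
      self_mem_nhdsWithin).exists
  obtain ⟨φ, hφm, hφ1, ⟨t, ht, hφt⟩, hφf⟩ := exists_boundary_cutoff hn hΩ.isOpen hne hlam
    (by positivity) hf.hasMeanOscLE hM hgrowth hT (by positivity : 0 < η / 5) hsmall
  rw [mul_div_cancel₀ _ (by norm_num : (5 : ℝ) ≠ 0)] at hφf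
  have hφmem : MemBmo (naturalScale n ε δ) Ω (φ * f) :=
    ⟨fun a l hl hQ => integrableOn_mul_cutoff hφm hφ1 (hf.1 a l hl hQ),
      hφf.trans_lt ENNReal.ofReal_lt_top⟩
  refine ⟨f - φ * f, hf.sub hφmem, ?_, by rwa [sub_sub_cancel]⟩
  refine (ENNReal.ofReal_pos.2 ht).trans_le (le_iInf₂ fun x hx => ?_)
  by_contra! hlt
  obtain ⟨y, hy, hxy⟩ := Metric.infEDist_lt_iff.1 hlt
  rw [edist_dist, ENNReal.ofReal_lt_ofReal_iff ht] at hxy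
  refine notMem_suppIn (Metric.ball_mem_nhds x (sub_pos.2 hxy)) (fun z hz hzΩ => ?_) hx
  have hyΩ : y ∈ Ωᶜ := by
    have := hy.2
    rwa [hΩ.isOpen.interior_eq] at this
  have h1 : Metric.infDist z Ωᶜ < t := by
    have h2 := Metric.infDist_le_dist_of_mem (x := z) hyΩ
    have h3 := dist_triangle z x y
    rw [Metric.mem_ball] at hz
    linarith
  simp [hφt z hzΩ h1]

/-- The cutoff at infinity is applied to an approximating function `g` with support away from the
boundary, so that its radius may depend on the growth of `g`. -/
theorem IsEpsDeltaDomain.exists_memBmoC_approx {ε δ : ℝ} (hΩ : IsEpsDeltaDomain ε δ Ω)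
    (hn : 1 ≤ n) (hf : MemBmo (naturalScale n ε δ) Ω f)
    (hv : VanishesAtBoundary (naturalScale n ε δ) Ω f)
    (hv' : VanishesAtInfinity (naturalScale n ε δ) Ω f) {η : ℝ} (hη : 0 < η) :
    ∃ g, MemBmoC (naturalScale n ε δ) Ω g ∧
      bmoNorm (naturalScale n ε δ) Ω (f - g) ≤ ENNReal.ofReal (9 * η) := by
  have hlam := naturalScale_pos hn hΩ.eps_pos hΩ.delta_pos
  obtain ⟨g, hg, hsupp, hfg⟩ := hΩ.exists_setDist_pos_approx hn hf hv hη
  obtain ⟨M, hM, hgrowth⟩ := hΩ.exists_hasLogGrowth hn hg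
  obtain ⟨C, hC⟩ : ∃ C, C = M * √n * (naturalScale n ε δ + 1) := ⟨_, rfl⟩
  obtain ⟨R, hRf, hR0, hRlam, hRC⟩ := ((ENNReal.tendsto_nhds_zero.1 hv' (ENNReal.ofReal η)
    (by positivity)).and ((eventually_gt_atTop (0 : ℝ)).and
      ((eventually_ge_atTop (2 * √n * naturalScale n ε δ)).and
        (eventually_ge_atTop (C / η))))).exists
  have hRC' : C / R ≤ η := by
    rw [div_le_iff₀ hη] at hRC
    rw [div_le_iff₀ hR0]
    linarith
  have hgR : bmoNorm (naturalScale n ε δ) (Ω \ Metric.closedBall 0 R) g ≤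
      ENNReal.ofReal η + ENNReal.ofReal η := by
    refine (hg.bmoNorm_le_add hf sdiff_subset).trans (add_le_add ?_ hRf)
    rwa [← neg_sub, bmoNorm_neg]
  have hφg : bmoNorm (naturalScale n ε δ) Ω (infinityCutoff n R * g) ≤ ENNReal.ofReal (8 * η) := by
    refine (bmoNorm_infinityCutoff_mul_le hlam hg.1 hM hgrowth hR0 hRlam hgR).trans ?_
    rw [← hC]
    calc 2 * (ENNReal.ofReal η + ENNReal.ofReal η + ENNReal.ofReal (C / R)) +
          (ENNReal.ofReal η + ENNReal.ofReal η)
        ≤ 2 * (ENNReal.ofReal η + ENNReal.ofReal η + ENNReal.ofReal η) +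
          (ENNReal.ofReal η + ENNReal.ofReal η) := by gcongr
      _ = ENNReal.ofReal (8 * η) := by
          rw [ENNReal.ofReal_mul (by norm_num), ENNReal.ofReal_ofNat]
          ring
  have hφmem : MemBmo (naturalScale n ε δ) Ω (infinityCutoff n R * g) :=
    ⟨fun a l hl hQ => integrableOn_mul_cutoff (measurable_infinityCutoff R)
      (abs_infinityCutoff_le R) (hg.1 a l hl hQ), hφg.trans_lt ENNReal.ofReal_lt_top⟩
  have hsub : suppIn Ω (g - infinityCutoff n R * g) ⊆ suppIn Ω g := by
    refine suppIn_mono fun x hx hx0 => hx ?_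
    simp [hx0]
  refine ⟨g - infinityCutoff n R * g, ⟨hg.sub hφmem, ?_,
    hsub.trans (suppIn_subset_of_setDist_pos hΩ.isOpen hsupp)⟩, ?_⟩
  · refine (isCompact_closedBall (0 : EuclideanSpace ℝ (Fin n)) (3 * R)).of_isClosed_subset
      isClosed_suppIn fun x hx => ?_
    by_contra hxR
    refine notMem_suppIn (Metric.isClosed_closedBall.isOpen_compl.mem_nhds hxR)
      (fun y hy _ => ?_) hx
    rw [mem_compl_iff, mem_closedBall_zero_iff, not_le] at hy
    simp [infinityCutoff_eq_one hR0 hy.le]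
  · have h1 : f - (g - infinityCutoff n R * g) = (f - g) - (-(infinityCutoff n R * g)) := by
      ring
    rw [h1]
    refine (bmoNorm_sub_le (hf.sub hg).1 hφmem.neg.1).trans ?_
    rw [bmoNorm_neg]
    refine (add_le_add hfg hφg).trans (le_of_eq ?_)
    rw [← ENNReal.ofReal_add (by positivity) (by positivity)]
    congr 1
    ring

end Approximation

/-! ### The characterizations of vanishing at the boundary and at infinity -/

theorem proposition3 (n : ℕ) (hn : 1 ≤ n) (ε δ : ℝ) (Ω : Set (EuclideanSpace ℝ (Fin n)))
    (hΩ : IsEpsDeltaDomain ε δ Ω) (f : EuclideanSpace ℝ (Fin n) → ℝ)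
    (hf : MemBmo (naturalScale n ε δ) Ω f) :
    ((∃ F : ℕ → EuclideanSpace ℝ (Fin n) → ℝ,
        (∀ j, MemBmo (naturalScale n ε δ) Ω (F j) ∧ 0 < setDist (suppIn Ω (F j)) (frontier Ω)) ∧
        Tendsto (fun j => bmoNorm (naturalScale n ε δ) Ω (F j - f)) atTop (𝓝 0)) ↔
      VanishesAtBoundary (naturalScale n ε δ) Ω f) ∧
    (InBmoClosure (naturalScale n ε δ) Ω {g | MemBmoC (naturalScale n ε δ) Ω g} f ↔
      VanishesAtBoundary (naturalScale n ε δ) Ω f ∧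
      VanishesAtInfinity (naturalScale n ε δ) Ω f) := by
  refine ⟨⟨?_, fun hv => ?_⟩, fun h => ⟨?_, ?_⟩, fun ⟨hv, hv'⟩ η hη => ?_⟩
  · rintro ⟨F, hF, hlim⟩
    refine hf.vanishesAtBoundary_of_approx fun η hη => ?_
    obtain ⟨j, hj⟩ := (ENNReal.tendsto_nhds_zero.1 hlim η hη).exists
    exact ⟨F j, (hF j).1, (hF j).2, by rwa [← neg_sub, bmoNorm_neg]⟩
  · choose F hF using fun j : ℕ => hΩ.exists_setDist_pos_approx hn hf hv
      (η := 1 / ((j : ℝ) + 1)) (by positivity)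
    refine ⟨F, fun j => ⟨(hF j).1, (hF j).2.1⟩, ?_⟩
    have hlim : Tendsto (fun j : ℕ => ENNReal.ofReal (1 / ((j : ℝ) + 1))) atTop (𝓝 0) := by
      rw [← ENNReal.ofReal_zero]
      exact (ENNReal.continuous_ofReal.tendsto 0).comp tendsto_one_div_add_atTop_nhds_zero_nat
    refine tendsto_of_tendsto_of_tendsto_of_le_of_le tendsto_const_nhds hlim
      (fun _ => bot_le) fun j => ?_
    simp only
    rw [← neg_sub, bmoNorm_neg]
    exact (hF j).2.2
  · refine hf.vanishesAtBoundary_of_approx fun η hη => ?_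
    obtain ⟨g, hg, hfg⟩ := h η hη
    refine ⟨g, hg.1, setDist_pos_of_isCompact hg.2.1 isClosed_frontier ?_, hfg.le⟩
    exact disjoint_left.2 fun x hx hxf =>
      hxf.2 (by rw [hΩ.isOpen.interior_eq]; exact hg.2.2 hx)
  · refine hf.vanishesAtInfinity_of_approx fun η hη => ?_
    obtain ⟨g, hg, hfg⟩ := h η hη
    exact ⟨g, hg.1, hg.2.1, hfg.le⟩
  · obtain ⟨θ, -, hθ0, hθ⟩ := ENNReal.lt_iff_exists_real_btwn.1 hη
    rw [ENNReal.ofReal_pos] at hθ0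
    obtain ⟨g, hg, hfg⟩ := hΩ.exists_memBmoC_approx hn hf hv hv' (by positivity : 0 < θ / 9)
    rw [mul_div_cancel₀ _ (by norm_num : (9 : ℝ) ≠ 0)] at hfg
    exact ⟨g, hg, hfg.trans_lt hθ⟩
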